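/- Let $n\ge 1$. Let $\mathrm{Conv}_{\rm c}(\mathbb{R}^n)$ be the class of convex, lower semicontinuous functions $\psi:\mathbb{R}^n\to(-\infty,+\infty]$ with $\psi\not\equiv+\infty$ and $\lim_{\|x\|\to\infty}\psi(x)=+\infty$, and let $\mathrm{LC}_{\rm c}(\mathbb{R}^n)=\{e^{-\psi}:\psi\in\mathrm{Conv}_{\rm c}(\mathbb{R}^n)\}$. For a unit vector $u$ put $R_u(x)=x-2\langle x,u\rangle u$ and let the Minkowski symmetral of $\psi\in\mathrm{Conv}_{\rm c}(\mathbb{R}^n)$ be $$(\tau_u\psi)(x)=\inf_{y+z=x}\left\{\tfrac12\psi(2y)+\tfrac12\psi(R_u(2z))\right\}.$$ A sequence $\psi_j$ epi-converges to $\varphi$ if for every $x\in\mathbb{R}^n$ one has $\varphi(x)\le\liminf_j\psi_j(x_j)$ for every sequence $x_j\to x$, and $\varphi(x)=\lim_j\psi_j(x_j)$ for at least one sequence $x_j\to x$. For $f=e^{-\psi}\in\mathrm{LC}_{\rm c}(\mathbb{R}^n)$, a hypo-symmetrization of $f$ is a function $f_{\rm sym}=e^{-\psi_{\rm sym}}$,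 where $\psi_{\rm sym}\in\mathrm{Conv}_{\rm c}(\mathbb{R}^n)$ is invariant under all linear isometries of $\mathbb{R}^n$ and there are unit vectors $u_1,u_2,\ldots$ such that $\tau_{u_m}\cdots\tau_{u_1}\psi$ epi-converges to $\psi_{\rm sym}$ as $m\to\infty$. Then for every $f\in\mathrm{LC}_{\rm c}(\mathbb{R}^n)$: $f$ is integrable, $f$ has a hypo-symmetrization, and every hypo-symmetrization $f_{\rm sym}$ of $f$ is integrable and satisfies $$J(f)\le J(f_{\rm sym}),\qquad\text{where } J(g)=\int_{\mathbb{R}^n}g(x)\,dx .$$ -/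

import Mathlib

open Filter Topology MeasureTheory

noncomputable section

namespace HypoSym

/-- Convexity of an extended-real-valued function, through its epigraph. -/
def ConvexFun {n : ℕ} (ψ : EuclideanSpace ℝ (Fin n) → EReal) : Prop :=
  Convex ℝ {p : EuclideanSpace ℝ (Fin n) × ℝ | ψ p.1 ≤ (p.2 : EReal)}

/-- The class `Conv_c(ℝⁿ)`: convex, proper, lower semicontinuous, coercive functions
`ψ : ℝⁿ → (-∞, +∞]`. -/
structure IsConvC {n : ℕ} (ψ : EuclideanSpace ℝ (Fin n) → EReal) : Prop where
  convex : ConvexFun ψ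
  ne_bot : ∀ x, ψ x ≠ ⊥
  dom_nonempty : ∃ x, ψ x < ⊤
  lsc : LowerSemicontinuous ψ
  coercive : Tendsto ψ (Bornology.cobounded (EuclideanSpace ℝ (Fin n))) (𝓝 ⊤)

/-- The function `e^{-ψ}`, with `e^{-∞} = 0`. It is real-valued as `ψ` never takes the value
`-∞` where this is used. -/
def expNeg {n : ℕ} (ψ : EuclideanSpace ℝ (Fin n) → EReal) : EuclideanSpace ℝ (Fin n) → ℝ :=
  fun x => (EReal.exp (-ψ x)).toReal

/-- The class `LC_c(ℝⁿ)` of functions `e^{-ψ}` with `ψ ∈ Conv_c(ℝⁿ)`. -/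
def LCc (n : ℕ) : Set (EuclideanSpace ℝ (Fin n) → ℝ) :=
  {f | ∃ ψ, IsConvC ψ ∧ f = expNeg ψ}

/-- Total mass `J(f) = ∫ f`. -/
def totalMass {n : ℕ} (f : EuclideanSpace ℝ (Fin n) → ℝ) : ℝ := ∫ x, f x

/-- Infimal convolution `(φ □ ψ)(x) = inf_{y + z = x} (φ(y) + ψ(z))`. -/
def infConv {n : ℕ} (φ ψ : EuclideanSpace ℝ (Fin n) → EReal) :
    EuclideanSpace ℝ (Fin n) → EReal :=
  fun x => ⨅ y, φ y + ψ (x - y)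

/-- Epi-multiplication `x ↦ c ψ(x / c)`, for `c > 0`. -/
def epiMul {n : ℕ} (c : ℝ) (ψ : EuclideanSpace ℝ (Fin n) → EReal) :
    EuclideanSpace ℝ (Fin n) → EReal :=
  fun x => (c : EReal) * ψ (c⁻¹ • x)

/-- The reflection `R_u ψ = ψ ∘ R_u`, where `R_u` reflects in the hyperplane `u^⊥`. -/
def reflFun {n : ℕ} (u : EuclideanSpace ℝ (Fin n)) (ψ : EuclideanSpace ℝ (Fin n) → EReal) :
    EuclideanSpace ℝ (Fin n) → EReal :=
  fun x => ψ ((Submodule.span ℝ {u})ᗮ.reflection x)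

/-- The Minkowski symmetral of `ψ` in the direction `u`. -/
def minkSym {n : ℕ} (u : EuclideanSpace ℝ (Fin n)) (ψ : EuclideanSpace ℝ (Fin n) → EReal) :
    EuclideanSpace ℝ (Fin n) → EReal :=
  infConv (epiMul (1 / 2) ψ) (epiMul (1 / 2) (reflFun u ψ))

/-- Successive Minkowski symmetrals, in the directions `u 0`, `u 1`, …, `u (m - 1)` in this
order. -/
def iterMinkSym {n : ℕ} (u : ℕ → EuclideanSpace ℝ (Fin n))
    (ψ : EuclideanSpace ℝ (Fin n) → EReal) : ℕ → EuclideanSpace ℝ (Fin n) → EReal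
  | 0 => ψ
  | m + 1 => minkSym (u m) (iterMinkSym u ψ m)

/-- Epi-convergence of a sequence of functions. -/
def EpiConverges {n : ℕ} (Ψ : ℕ → EuclideanSpace ℝ (Fin n) → EReal)
    (φ : EuclideanSpace ℝ (Fin n) → EReal) : Prop :=
  ∀ x,
    (∀ y : ℕ → EuclideanSpace ℝ (Fin n), Tendsto y atTop (𝓝 x) →
      φ x ≤ liminf (fun j => Ψ j (y j)) atTop) ∧
    ∃ y : ℕ → EuclideanSpace ℝ (Fin n), Tendsto y atTop (𝓝 x) ∧
      Tendsto (fun j => Ψ j (y j)) atTop (𝓝 (φ x))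

/-- `φ` is an epi-symmetrization `ψ_sym` of `ψ`: a member of `Conv_c(ℝⁿ)`, invariant under
linear isometries, which is the epi-limit of successive Minkowski symmetrals of `ψ`. -/
structure IsEpiSymmetrization {n : ℕ} (ψ φ : EuclideanSpace ℝ (Fin n) → EReal) : Prop where
  isConvC : IsConvC φ
  invariant : ∀ (A : EuclideanSpace ℝ (Fin n) ≃ₗᵢ[ℝ] EuclideanSpace ℝ (Fin n)) (x),
    φ (A x) = φ x
  epiLimit : ∃ u : ℕ → EuclideanSpace ℝ (Fin n), (∀ i, ‖u i‖ = 1) ∧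
    EpiConverges (iterMinkSym u ψ) φ

/-- `g` is a hypo-symmetrization `f_sym = e^{-ψ_sym}` of `f = e^{-ψ}`. -/
def IsHypoSymmetrization {n : ℕ} (f g : EuclideanSpace ℝ (Fin n) → ℝ) : Prop :=
  ∃ ψ φ, IsConvC ψ ∧ f = expNeg ψ ∧ IsEpiSymmetrization ψ φ ∧ g = expNeg φ

end HypoSym

end

noncomputable section

namespace HypoSym

/-! Mass inequality. If `K` is the sublevel set of `ψ` at some height, the sublevel set of `minkSym
u ψ` at that height contains the mean of `K` and its reflection, hence the Steiner symmetral of `K`;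
Fubini along `u` bounds the volume below (`volume_le_of_mean_refl`), and the layer cake formula
gives `IsConvC.lintegral_le_minkSym`. All symmetrals inherit one linear growth bound, so the reverse
Fatou lemma and the lower half of epi-convergence pass to the limit
(`IsEpiSymmetrization.totalMass_le`).

Existence, by duality. The conjugate of `minkSym u ψ` is the mean of the conjugate of `ψ` and its
reflection, on the intersection of the domain with its reflection (`dual_minkSym`,
`mem_dualDom_minkSym`). On a sphere well inside the domain, an oscillation above `ε` leaves a cap
below the maximum, and boundedly many reflections spread this deficit over the sphere
(`exists_listMean_osc_le`). Likewise a point missing from the domain yields a missing cap on any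
larger sphere, which reflections spread (`exists_dualDom_disjoint`). Further symmetrization destroys
neither gain, so one sequence of directions meets countably many such goals (`exists_directions`).
The conjugates then converge to a radial `α`, uniformly on balls compactly inside the inball of the
domain. The conjugate of `α` over that inball is the epi-limit: Fenchel's inequality gives the lower
bound, and separation of a ball from an epigraph gives recovery sequences (`eventually_exists_le`).
-/

/-- The reflection in the hyperplane `u^⊥`. -/
abbrev refl {n : ℕ} (u : EuclideanSpace ℝ (Fin n)) :
    EuclideanSpace ℝ (Fin n) ≃ₗᵢ[ℝ] EuclideanSpace ℝ (Fin n) :=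
  (Submodule.span ℝ {u})ᗮ.reflection

/-! ### Linear growth, and stability of the class under Minkowski symmetrization. -/

section Basics

variable {n : ℕ} {ψ : EuclideanSpace ℝ (Fin n) → EReal}

lemma exists_coe_of_lt_top {ψ : EuclideanSpace ℝ (Fin n) → EReal} (h : ∀ x, ψ x ≠ ⊥)
    {x : EuclideanSpace ℝ (Fin n)} (hx : ψ x < ⊤) : ∃ s : ℝ, ψ x = s :=
  ⟨(ψ x).toReal, (EReal.coe_toReal hx.ne (h x)).symm⟩

/-- A lower bound of an extended real can be tested on its real upper bounds. -/
lemma coe_le_of_forall_le {c : ℝ} {w : EReal} (h : ∀ s : ℝ, w ≤ s → c ≤ s) : (c : EReal) ≤ w := by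
  induction w with
  | bot => have := h (c - 1) bot_le; linarith
  | coe r => exact_mod_cast h r le_rfl
  | top => exact le_top

lemma ConvexFun.combo (h : ConvexFun ψ) {x y : EuclideanSpace ℝ (Fin n)} {s t a b : ℝ}
    (hx : ψ x ≤ s) (hy : ψ y ≤ t) (ha : 0 ≤ a) (hb : 0 ≤ b) (hab : a + b = 1) :
    ψ (a • x + b • y) ≤ ((a * s + b * t : ℝ) : EReal) :=
  h (x := (x, s)) hx (y := (y, t)) hy ha hb hab

lemma IsConvC.exists_lower_bound_ball (h : IsConvC ψ) (r : ℝ) :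
    ∃ m : ℝ, ∀ x, ‖x‖ ≤ r → (m : EReal) ≤ ψ x := by
  by_cases hr : 0 ≤ r
  · obtain ⟨x₀, hx₀, hmin⟩ := LowerSemicontinuousOn.exists_isMinOn
      (s := Metric.closedBall (0 : EuclideanSpace ℝ (Fin n)) r) ⟨0, by simpa using hr⟩
      (isCompact_closedBall _ _) (h.lsc.lowerSemicontinuousOn _)
    have hle : ∀ x, ‖x‖ ≤ r → ψ x₀ ≤ ψ x := fun x hx => hmin (by simpa using hx)
    rcases eq_or_ne (ψ x₀) ⊤ with ht | ht
    · exact ⟨0, fun x hx => le_trans (by rw [ht]; exact le_top) (hle x hx)⟩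
    · obtain ⟨s, hs⟩ := exists_coe_of_lt_top h.ne_bot (lt_top_iff_ne_top.2 ht)
      exact ⟨s, fun x hx => hs ▸ hle x hx⟩
  · exact ⟨0, fun x hx => absurd ((norm_nonneg x).trans hx) hr⟩

/-- Coercive convex functions grow at least linearly. -/
theorem IsConvC.exists_growth (h : IsConvC ψ) :
    ∃ a > 0, ∃ b : ℝ, ∀ x, ((a * ‖x‖ + b : ℝ) : EReal) ≤ ψ x := by
  obtain ⟨x₀, hx₀⟩ := h.dom_nonempty
  obtain ⟨s₀, hs₀⟩ := exists_coe_of_lt_top h.ne_bot hx₀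
  obtain ⟨r₀, hr₀⟩ : ∃ r₀ : ℝ, ∀ x, r₀ < ‖x‖ → ((s₀ + 1 : ℝ) : EReal) < ψ x := by
    have := h.coercive.eventually (lt_mem_nhds (EReal.coe_lt_top (s₀ + 1)))
    rw [← comap_norm_atTop, eventually_comap] at this
    obtain ⟨r, hr⟩ := eventually_atTop.1 this
    exact ⟨r, fun x hx => hr _ hx.le x rfl⟩
  -- The sphere of radius `r` about `x₀` lies outside the ball of radius `r₀` about the origin, so
  -- `ψ` exceeds `s₀ + 1` there.
  set r : ℝ := max r₀ 0 + ‖x₀‖ + 1 with hr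
  have hr0 : 0 < r := by positivity
  have hr1 : r₀ ≤ max r₀ 0 := le_max_left _ _
  obtain ⟨m, hm⟩ := h.exists_lower_bound_ball (r + ‖x₀‖)
  refine ⟨r⁻¹, by positivity, min (m - r⁻¹ * (r + ‖x₀‖)) (s₀ - r⁻¹ * ‖x₀‖), fun y => ?_⟩
  by_cases hy : ‖y - x₀‖ ≤ r
  · have hy' : ‖y‖ ≤ r + ‖x₀‖ := by
      calc ‖y‖ = ‖(y - x₀) + x₀‖ := by simp
        _ ≤ _ := (norm_add_le _ _).trans (by linarith)
    refine le_trans ?_ (hm y hy')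
    rw [EReal.coe_le_coe_iff]
    have h1 : r⁻¹ * ‖y‖ ≤ r⁻¹ * (r + ‖x₀‖) := by gcongr
    have h2 := min_le_left (m - r⁻¹ * (r + ‖x₀‖)) (s₀ - r⁻¹ * ‖x₀‖)
    linarith
  · push Not at hy
    refine coe_le_of_forall_le fun s hs => ?_
    -- The segment from `x₀` to `y` crosses that sphere at parameter `l`; convexity then forces
    -- average slope at least `1 / r` from `x₀` to `y`.
    set l : ℝ := r / ‖y - x₀‖ with hl
    have hd : 0 < ‖y - x₀‖ := hr0.trans hy
    have hl0 : 0 < l := by positivity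
    have hl1 : l ≤ 1 := by rw [hl, div_le_one hd]; exact hy.le
    have hc := h.convex.combo (x := x₀) (y := y) (s := s₀) (t := s) (a := 1 - l) (b := l)
      hs₀.le hs (by linarith) hl0.le (by ring)
    have hz : r₀ < ‖(1 - l) • x₀ + l • y‖ := by
      have e : (1 - l) • x₀ + l • y = l • (y - x₀) + x₀ := by module
      have h1 : ‖l • (y - x₀)‖ = r := by
        rw [norm_smul, Real.norm_of_nonneg hl0.le, hl]; field_simp
      have h2 : ‖l • (y - x₀)‖ ≤ ‖l • (y - x₀) + x₀‖ + ‖x₀‖ := by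
        simpa using norm_sub_le (l • (y - x₀) + x₀) x₀
      rw [e]; rw [h1] at h2; linarith
    have h3 := (hr₀ _ hz).trans_le hc
    rw [EReal.coe_lt_coe_iff] at h3
    have h4 : 1 ≤ l * (s - s₀) := by nlinarith
    have h5 : ‖y - x₀‖ / r ≤ s - s₀ := by
      rw [hl] at h4
      rw [div_le_iff₀ hr0]
      rw [div_mul_eq_mul_div, le_div_iff₀ hd] at h4
      linarith
    have h6 : ‖y‖ ≤ ‖y - x₀‖ + ‖x₀‖ := by simpa using norm_add_le (y - x₀) x₀
    have h7 : r⁻¹ * ‖y‖ ≤ r⁻¹ * (‖y - x₀‖ + ‖x₀‖) := by gcongr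
    have h8 : r⁻¹ * ‖y - x₀‖ = ‖y - x₀‖ / r := by field_simp
    have h2 := min_le_right (m - r⁻¹ * (r + ‖x₀‖)) (s₀ - r⁻¹ * ‖x₀‖)
    nlinarith

lemma refl_refl (u x : EuclideanSpace ℝ (Fin n)) : refl u (refl u x) = x :=
  Submodule.reflection_reflection _ x

lemma inner_refl_right (u x y : EuclideanSpace ℝ (Fin n)) :
    inner ℝ x (refl u y) = inner ℝ (refl u x) y := by
  rw [← (refl u).inner_map_map x, refl_refl]

lemma minkSym_apply (u : EuclideanSpace ℝ (Fin n)) (ψ : EuclideanSpace ℝ (Fin n) → EReal)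
    (x : EuclideanSpace ℝ (Fin n)) : minkSym u ψ x =
      ⨅ y, ((1 / 2 : ℝ) : EReal) * ψ ((1 / 2 : ℝ)⁻¹ • y) +
        ((1 / 2 : ℝ) : EReal) * ψ (refl u ((1 / 2 : ℝ)⁻¹ • (x - y))) := rfl

lemma minkSym_le (u : EuclideanSpace ℝ (Fin n)) {y z : EuclideanSpace ℝ (Fin n)} {s t : ℝ}
    (hy : ψ y ≤ s) (hz : ψ z ≤ t) :
    minkSym u ψ ((1 / 2 : ℝ) • (y + refl u z)) ≤ (((s + t) / 2 : ℝ) : EReal) := by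
  rw [minkSym_apply]
  refine (iInf_le _ ((1 / 2 : ℝ) • y)).trans ?_
  have e1 : (1 / 2 : ℝ)⁻¹ • (1 / 2 : ℝ) • y = y := by
    rw [smul_smul]; norm_num
  have e2 : (1 / 2 : ℝ)⁻¹ • ((1 / 2 : ℝ) • (y + refl u z) - (1 / 2 : ℝ) • y) = refl u z := by
    rw [← smul_sub, smul_smul]; norm_num
  rw [e1, e2, refl_refl]
  have h0 : (0 : EReal) ≤ ((1 / 2 : ℝ) : EReal) := by norm_cast; norm_num
  calc _ ≤ ((1 / 2 : ℝ) : EReal) * (s : EReal) + ((1 / 2 : ℝ) : EReal) * (t : EReal) := by gcongr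
    _ = _ := by norm_cast; ring

lemma half_mul_ne_bot {w : EReal} (h : w ≠ ⊥) : ((1 / 2 : ℝ) : EReal) * w ≠ ⊥ := by
  induction w with
  | bot => exact absurd rfl h
  | coe r => rw [← EReal.coe_mul]; exact EReal.coe_ne_bot _
  | top => rw [EReal.coe_mul_top_of_pos (by norm_num)]; simp

lemma exists_of_half_add_half_le {v w : EReal} (hv : v ≠ ⊥) (hw : w ≠ ⊥) {t : ℝ}
    (h : ((1 / 2 : ℝ) : EReal) * v + ((1 / 2 : ℝ) : EReal) * w ≤ t) :
    ∃ r s : ℝ, v ≤ r ∧ w ≤ s ∧ (r + s) / 2 = t := by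
  have ht : ((1 / 2 : ℝ) : EReal) * ⊤ = ⊤ := EReal.coe_mul_top_of_pos (by norm_num)
  induction v with
  | bot => exact absurd rfl hv
  | top => rw [ht, EReal.top_add_of_ne_bot (half_mul_ne_bot hw)] at h; simp at h
  | coe r =>
    induction w with
    | bot => exact absurd rfl hw
    | top => rw [ht, EReal.add_top_of_ne_bot (half_mul_ne_bot hv)] at h; simp at h
    | coe s =>
      refine ⟨r, 2 * t - r, le_rfl, ?_, by ring⟩
      norm_cast at h ⊢
      linarith

/-- The infimum defining the Minkowski symmetral is attained: its epigraph is the mean of the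
epigraph of `ψ` and of its reflection. -/
theorem IsConvC.minkSym_le_iff (h : IsConvC ψ) (u : EuclideanSpace ℝ (Fin n))
    {x : EuclideanSpace ℝ (Fin n)} {t : ℝ} : minkSym u ψ x ≤ t ↔
      ∃ (y z : EuclideanSpace ℝ (Fin n)) (r s : ℝ), ψ y ≤ r ∧ ψ z ≤ s ∧
        x = (1 / 2 : ℝ) • (y + refl u z) ∧ (r + s) / 2 = t := by
  constructor
  swap
  · rintro ⟨y, z, r, s, hy, hz, rfl, rfl⟩
    exact minkSym_le u hy hz
  intro hx
  rw [minkSym_apply] at hx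
  obtain ⟨a, ha, b, hb⟩ := h.exists_growth
  set g : EuclideanSpace ℝ (Fin n) → EReal := fun y =>
    ((1 / 2 : ℝ) : EReal) * ψ ((1 / 2 : ℝ)⁻¹ • y) +
        ((1 / 2 : ℝ) : EReal) * ψ (refl u ((1 / 2 : ℝ)⁻¹ • (x - y))) with hg
  have hhalf : Continuous fun w : EReal => ((1 / 2 : ℝ) : EReal) * w := by
    rw [continuous_iff_continuousAt]
    intro w
    exact EReal.Tendsto.const_mul tendsto_id (Or.inl (EReal.coe_ne_bot _)) (Or.inl (EReal.coe_ne_top _))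
  have hmono : Monotone fun w : EReal => ((1 / 2 : ℝ) : EReal) * w := by
    intro v w hvw
    have h0 : (0 : EReal) ≤ ((1 / 2 : ℝ) : EReal) := by norm_cast; norm_num
    exact mul_le_mul_of_nonneg_left hvw h0
  have hlsc : LowerSemicontinuous g := by
    refine LowerSemicontinuous.add' ?_ ?_ ?_
    · exact hhalf.comp_lowerSemicontinuous
        (h.lsc.comp (continuous_const_smul _)) hmono
    · exact hhalf.comp_lowerSemicontinuous (h.lsc.comp
        (g := fun y => refl u ((1 / 2 : ℝ)⁻¹ • (x - y))) (by fun_prop)) hmono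
    · intro y
      exact EReal.continuousAt_add (Or.inr (half_mul_ne_bot (h.ne_bot _)))
        (Or.inl (half_mul_ne_bot (h.ne_bot _)))
  have hgrow : ∀ (y) (t : ℝ), g y ≤ t → a * ‖y‖ + b ≤ t := by
    intro y t hy
    obtain ⟨r, s, hr, hs, rfl⟩ := exists_of_half_add_half_le (h.ne_bot _) (h.ne_bot _) hy
    have h1 := (hb _).trans hr
    have h2 := (hb _).trans hs
    rw [EReal.coe_le_coe_iff] at h1 h2
    rw [norm_smul] at h1
    norm_num at h1
    have : 0 ≤ a * ‖refl u ((1 / 2 : ℝ)⁻¹ • (x - y))‖ := by positivity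
    linarith
  -- Outside this ball `hgrow` gives `g ≥ t + 1`, so an infimum at most `t` must be governed by the
  -- minimum over the ball.
  obtain ⟨y₀, -, hy₀⟩ := LowerSemicontinuousOn.exists_isMinOn
    (s := Metric.closedBall (0 : EuclideanSpace ℝ (Fin n)) (|t + 1 - b| / a))
    ⟨0, by simp; positivity⟩ (isCompact_closedBall _ _) (hlsc.lowerSemicontinuousOn _)
  have hgy : g y₀ ≤ t := by
    by_contra hcon
    push Not at hcon
    have : min (g y₀) ((t + 1 : ℝ) : EReal) ≤ ⨅ y, g y := by
      refine le_iInf fun y => ?_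
      by_cases hy : ‖y‖ ≤ |t + 1 - b| / a
      · exact (min_le_left _ _).trans (hy₀ (by simpa using hy))
      · refine (min_le_right _ _).trans (le_of_not_gt fun hlt => hy ?_)
        have := hgrow y _ hlt.le
        rw [le_div_iff₀ ha]
        have := le_abs_self (t + 1 - b)
        linarith
    have h2 : (t : EReal) < min (g y₀) ((t + 1 : ℝ) : EReal) :=
      lt_min hcon (by norm_cast; linarith)
    exact absurd (h2.trans_le (this.trans hx)) (lt_irrefl _)
  obtain ⟨r, s, hr, hs, hrs⟩ := exists_of_half_add_half_le (h.ne_bot _) (h.ne_bot _) hgy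
  refine ⟨_, _, r, s, hr, hs, ?_, hrs⟩
  rw [refl_refl, ← smul_add, smul_smul]
  norm_num

/-- The norm is convex and reflection-invariant, so the constants `a`, `b` do not deteriorate; one
integrable majorant then serves all iterates. -/
lemma IsConvC.growth_minkSym (h : IsConvC ψ) (u : EuclideanSpace ℝ (Fin n)) {a b : ℝ}
    (ha : 0 ≤ a) (hb : ∀ x, ((a * ‖x‖ + b : ℝ) : EReal) ≤ ψ x) (x : EuclideanSpace ℝ (Fin n)) :
    ((a * ‖x‖ + b : ℝ) : EReal) ≤ minkSym u ψ x := by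
  refine coe_le_of_forall_le fun t ht => ?_
  obtain ⟨y, z, r, s, hy, hz, rfl, rfl⟩ := (h.minkSym_le_iff u).1 ht
  have h1 := (hb _).trans hy
  have h2 := (hb _).trans hz
  rw [EReal.coe_le_coe_iff] at h1 h2
  have h3 : ‖(1 / 2 : ℝ) • (y + refl u z)‖ ≤ (‖y‖ + ‖z‖) / 2 := by
    rw [norm_smul]
    have := norm_add_le y (refl u z)
    rw [LinearIsometryEquiv.norm_map] at this
    norm_num
    linarith
  nlinarith [mul_le_mul_of_nonneg_left h3 ha]

lemma coercive_of_growth {a b : ℝ} (ha : 0 < a)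
    (hb : ∀ x, ((a * ‖x‖ + b : ℝ) : EReal) ≤ ψ x) :
    Tendsto ψ (Bornology.cobounded (EuclideanSpace ℝ (Fin n))) (𝓝 ⊤) := by
  refine tendsto_nhds_top_mono (f := fun x => ((a * ‖x‖ + b : ℝ) : EReal)) ?_
    (Eventually.of_forall hb)
  rw [EReal.tendsto_coe_nhds_top_iff]
  exact tendsto_atTop_add_const_right _ _ (tendsto_norm_cobounded_atTop.const_mul_atTop ha)

theorem IsConvC.minkSym (h : IsConvC ψ) (u : EuclideanSpace ℝ (Fin n)) :
    IsConvC (minkSym u ψ) := by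
  obtain ⟨a, ha, b, hb⟩ := h.exists_growth
  have hgrow := h.growth_minkSym u ha.le hb
  refine ⟨?_, ?_, ?_, ?_, coercive_of_growth ha hgrow⟩
  · rintro ⟨x, t⟩ hx ⟨x', t'⟩ hx' c d hc hd hcd
    simp only [Set.mem_ofPred_eq] at hx hx'
    obtain ⟨y, z, r, s, hy, hz, rfl, rfl⟩ := (h.minkSym_le_iff u).1 hx
    obtain ⟨y', z', r', s', hy', hz', rfl, rfl⟩ := (h.minkSym_le_iff u).1 hx'
    refine (h.minkSym_le_iff u).2 ⟨c • y + d • y', c • z + d • z', c * r + d * r',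
      c * s + d * s', h.convex.combo hy hy' hc hd hcd, h.convex.combo hz hz' hc hd hcd, ?_, ?_⟩
    · simp only [Prod.smul_mk, Prod.mk_add_mk, map_add, map_smul]
      module
    · simp only [Prod.smul_mk, Prod.mk_add_mk, smul_eq_mul]
      ring
  · intro x hx
    have := hgrow x
    rw [hx] at this
    exact absurd (le_bot_iff.1 this) (EReal.coe_ne_bot _)
  · obtain ⟨x, hx⟩ := h.dom_nonempty
    obtain ⟨s, hs⟩ := exists_coe_of_lt_top h.ne_bot hx
    exact ⟨_, (minkSym_le u hs.le hs.le).trans_lt (EReal.coe_lt_top _)⟩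
  -- A sublevel set is the continuous image of the set `C` of triples `(y, z, r)` splitting the
  -- level `2 * t` as `r + (2 * t - r)`; growth makes `C` compact.
  · have hsub : ∀ t : ℝ, IsClosed {x | HypoSym.minkSym u ψ x ≤ t} := by
      intro t
      set C : Set ((EuclideanSpace ℝ (Fin n) × EuclideanSpace ℝ (Fin n)) × ℝ) :=
        {p | ψ p.1.1 ≤ (p.2 : EReal)} ∩ {p | ψ p.1.2 ≤ ((2 * t - p.2 : ℝ) : EReal)} with hC
      have hcl : IsClosed C := by
        have hepi : IsClosed {p : EuclideanSpace ℝ (Fin n) × EReal | ψ p.1 ≤ p.2} :=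
          h.lsc.isClosed_epigraph
        refine IsClosed.inter ?_ ?_
        · exact hepi.preimage (f := fun p : (EuclideanSpace ℝ (Fin n) ×
            EuclideanSpace ℝ (Fin n)) × ℝ => (p.1.1, (p.2 : EReal)))
            (by
              refine Continuous.prodMk (by fun_prop) ?_
              exact continuous_coe_real_ereal.comp continuous_snd)
        · exact hepi.preimage (f := fun p : (EuclideanSpace ℝ (Fin n) ×
            EuclideanSpace ℝ (Fin n)) × ℝ => (p.1.2, ((2 * t - p.2 : ℝ) : EReal)))
            (by
              refine Continuous.prodMk (by fun_prop) ?_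
              exact continuous_coe_real_ereal.comp (by fun_prop))
      have hbd : Bornology.IsBounded C := by
        refine (((Metric.isBounded_closedBall (x := (0 : EuclideanSpace ℝ (Fin n)))
          (r := (2 * t - 2 * b) / a)).prod (Metric.isBounded_closedBall
          (x := (0 : EuclideanSpace ℝ (Fin n))) (r := (2 * t - 2 * b) / a))).prod
          (Metric.isBounded_Icc b (2 * t - b))).subset ?_
        rintro ⟨⟨y, z⟩, r⟩ ⟨hy, hz⟩
        simp only [Set.mem_ofPred_eq] at hy hz
        have h1 := (hb _).trans hy
        have h2 := (hb _).trans hz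
        rw [EReal.coe_le_coe_iff] at h1 h2
        have h3 : 0 ≤ a * ‖y‖ := by positivity
        have h4 : 0 ≤ a * ‖z‖ := by positivity
        refine ⟨⟨?_, ?_⟩, ?_, ?_⟩
        · simp only [mem_closedBall_zero_iff, le_div_iff₀ ha]; linarith
        · simp only [mem_closedBall_zero_iff, le_div_iff₀ ha]; linarith
        · simp only; linarith
        · simp only; linarith
      have himg : {x | HypoSym.minkSym u ψ x ≤ t} =
          (fun p : (EuclideanSpace ℝ (Fin n) × EuclideanSpace ℝ (Fin n)) × ℝ =>
            (1 / 2 : ℝ) • (p.1.1 + refl u p.1.2)) '' C := by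
        ext x
        simp only [Set.mem_ofPred_eq, Set.mem_image, h.minkSym_le_iff u]
        constructor
        · rintro ⟨y, z, r, s, hy, hz, rfl, rfl⟩
          refine ⟨((y, z), r), ⟨hy, ?_⟩, rfl⟩
          simp only [Set.mem_ofPred_eq]
          convert hz using 2
          ring
        · rintro ⟨⟨⟨y, z⟩, r⟩, ⟨hy, hz⟩, rfl⟩
          exact ⟨y, z, r, _, hy, hz, rfl, by ring⟩
      rw [himg]
      have hK : IsCompact C := Metric.isCompact_of_isClosed_isBounded hcl hbd
      exact (hK.image (by fun_prop)).isClosed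
    rw [lowerSemicontinuous_iff_isClosed_preimage]
    intro w
    induction w with
    | bot =>
      have : HypoSym.minkSym u ψ ⁻¹' Set.Iic ⊥ = ∅ := by
        ext x
        simp only [Set.mem_preimage, Set.mem_Iic, Set.mem_empty_iff_false, iff_false]
        intro hx
        have := (hgrow x).trans hx
        exact absurd (le_bot_iff.1 this) (EReal.coe_ne_bot _)
      rw [this]; exact isClosed_empty
    | coe r => exact hsub r
    | top => simp

lemma IsConvC.iterMinkSym (h : IsConvC ψ) (u : ℕ → EuclideanSpace ℝ (Fin n)) (m : ℕ) :
    IsConvC (iterMinkSym u ψ m) := by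
  induction m with
  | zero => exact h
  | succ m ih => exact ih.minkSym _

lemma IsConvC.growth_iterMinkSym (h : IsConvC ψ) (u : ℕ → EuclideanSpace ℝ (Fin n)) {a b : ℝ}
    (ha : 0 ≤ a) (hb : ∀ x, ((a * ‖x‖ + b : ℝ) : EReal) ≤ ψ x) (m : ℕ)
    (x : EuclideanSpace ℝ (Fin n)) : ((a * ‖x‖ + b : ℝ) : EReal) ≤ HypoSym.iterMinkSym u ψ m x := by
  induction m generalizing x with
  | zero => exact hb x
  | succ m ih => exact (h.iterMinkSym u m).growth_minkSym _ ha ih x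

end Basics

/-! ### Integrability and monotonicity of the total mass. -/

section Mass

variable {n : ℕ} {ψ : EuclideanSpace ℝ (Fin n) → EReal}

/-- Comparison with `(1 + ‖x‖) ^ (-(n + 1))`, using `s ^ k / k! ≤ exp s` at `s = a * (1 + ‖x‖)`, `k
= n + 1`. -/
lemma integrable_exp_neg_norm {a : ℝ} (ha : 0 < a) (b : ℝ) :
    Integrable fun x : EuclideanSpace ℝ (Fin n) => Real.exp (-(a * ‖x‖ + b)) := by
  have hint := (integrable_one_add_norm (E := EuclideanSpace ℝ (Fin n)) (μ := volume)
    (r := ((n + 1 : ℕ) : ℝ)) (by simp)).const_mul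
      (((n + 1).factorial : ℝ) / a ^ (n + 1) * Real.exp (a - b))
  refine hint.mono' (by fun_prop) (Eventually.of_forall fun x => ?_)
  rw [Real.norm_of_nonneg (Real.exp_pos _).le, Real.rpow_neg (by positivity), Real.rpow_natCast]
  have h1 : 0 < 1 + ‖x‖ := by positivity
  have h2 := Real.pow_div_factorial_le_exp (a * (1 + ‖x‖)) (by positivity) (n + 1)
  rw [mul_pow] at h2
  have e : Real.exp (-(a * ‖x‖ + b)) = Real.exp (a - b) / Real.exp (a * (1 + ‖x‖)) := by
    rw [← Real.exp_sub]; congr 1; ring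
  rw [e, div_le_iff₀ (Real.exp_pos _)]
  calc Real.exp (a - b) = ((n + 1).factorial : ℝ) / a ^ (n + 1) * Real.exp (a - b) *
        ((1 + ‖x‖) ^ (n + 1))⁻¹ * (a ^ (n + 1) * (1 + ‖x‖) ^ (n + 1) / (n + 1).factorial) := by
        have := Nat.factorial_pos (n + 1)
        field_simp
    _ ≤ _ := by gcongr

lemma expNeg_le_of_le {x : EuclideanSpace ℝ (Fin n)} {c : ℝ} (h : (c : EReal) ≤ ψ x) :
    EReal.exp (-ψ x) ≤ ENNReal.ofReal (Real.exp (-c)) := by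
  rw [← EReal.exp_coe, EReal.coe_neg]
  exact EReal.exp_monotone (EReal.neg_le_neg_iff.2 h)

lemma IsConvC.measurable_exp_neg (h : IsConvC ψ) : Measurable fun x => EReal.exp (-ψ x) :=
  EReal.exp_monotone.measurable.comp h.lsc.measurable.neg

lemma IsConvC.exp_neg_ne_top (h : IsConvC ψ) (x : EuclideanSpace ℝ (Fin n)) :
    EReal.exp (-ψ x) ≠ ⊤ := by
  rw [Ne, EReal.exp_eq_top_iff, EReal.neg_eq_top_iff]
  exact h.ne_bot x

lemma IsConvC.lintegral_exp_neg_ne_top (h : IsConvC ψ) : ∫⁻ x, EReal.exp (-ψ x) ≠ ⊤ := by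
  obtain ⟨a, ha, b, hb⟩ := h.exists_growth
  exact ((lintegral_mono fun x => expNeg_le_of_le (hb x)).trans_lt
    (integrable_exp_neg_norm ha b).lintegral_lt_top).ne

theorem IsConvC.integrable_expNeg (h : IsConvC ψ) : Integrable (expNeg ψ) :=
  integrable_toReal_of_lintegral_ne_top h.measurable_exp_neg.aemeasurable
    h.lintegral_exp_neg_ne_top

lemma IsConvC.totalMass_expNeg (h : IsConvC ψ) :
    totalMass (expNeg ψ) = (∫⁻ x, EReal.exp (-ψ x)).toReal :=
  integral_toReal h.measurable_exp_neg.aemeasurable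
    (Eventually.of_forall fun x => lt_top_iff_ne_top.2 (h.exp_neg_ne_top x))

lemma IsConvC.le_expNeg_iff (h : IsConvC ψ) (x : EuclideanSpace ℝ (Fin n)) {t : ℝ} (ht : 0 < t) :
    t ≤ expNeg ψ x ↔ ψ x ≤ ((-Real.log t : ℝ) : EReal) := by
  have hb := h.ne_bot x
  unfold expNeg
  induction hw : ψ x with
  | bot => exact absurd hw hb
  | top => simpa using ht
  | coe r =>
    rw [← EReal.coe_neg, EReal.exp_coe, ENNReal.toReal_ofReal (Real.exp_pos _).le,
      EReal.coe_le_coe_iff, ← Real.log_le_iff_le_exp ht]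
    constructor <;> intro <;> linarith

/-- `K` is an interval, and the half-differences of pairs symmetric about its midpoint already fill
the centred interval of the same length. -/
lemma volume_le_of_symmetrized_slice {K L : Set ℝ} (hK : IsCompact K) (hc : Convex ℝ K)
    (hL : ∀ s ∈ K, ∀ s' ∈ K, (s - s') / 2 ∈ L) : volume K ≤ volume L := by
  rcases K.eq_empty_or_nonempty with rfl | hne
  · simp
  have ha := hK.sInf_mem hne
  have hb := hK.sSup_mem hne
  set a := sInf K
  set b := sSup K
  have h1 : K ⊆ Set.Icc a b := fun s hs =>
    ⟨csInf_le hK.bddBelow hs, le_csSup hK.bddAbove hs⟩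
  have h2 : Set.Icc a b ⊆ K := by
    intro s hs
    exact hc.ordConnected.out ha hb hs
  have h3 : Set.Icc (-((b - a) / 2)) ((b - a) / 2) ⊆ L := by
    rintro t ⟨ht1, ht2⟩
    have := hL ((a + b) / 2 + t) (h2 ⟨by linarith, by linarith⟩) ((a + b) / 2 - t)
      (h2 ⟨by linarith, by linarith⟩)
    convert this using 1
    ring
  calc volume K ≤ volume (Set.Icc a b) := measure_mono h1
    _ = volume (Set.Icc (-((b - a) / 2)) ((b - a) / 2)) := by
      rw [Real.volume_Icc, Real.volume_Icc]; congr 1; ring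
    _ ≤ volume L := measure_mono h3

/-- The mean of a convex body and its reflection has at least the volume of the body: along each
line orthogonal to the mirror it contains the Steiner symmetral. -/
theorem volume_le_of_mean_refl {u : EuclideanSpace ℝ (Fin n)} (hu : ‖u‖ = 1)
    {K L : Set (EuclideanSpace ℝ (Fin n))} (hK : IsCompact K) (hc : Convex ℝ K)
    (hLm : MeasurableSet L)
    (hL : ∀ y ∈ K, ∀ z ∈ K, (1 / 2 : ℝ) • (y + refl u z) ∈ L) : volume K ≤ volume L := by
  obtain _ | m := n
  · have : u = 0 := Subsingleton.elim _ _
    simp [this] at hu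
  obtain ⟨b, hb⟩ : ∃ b : OrthonormalBasis (Fin (m + 1)) ℝ (EuclideanSpace ℝ (Fin (m + 1))),
      b 0 = u := by
    obtain ⟨b, hb⟩ := Orthonormal.exists_orthonormalBasis_extension_of_card_eq (𝕜 := ℝ)
      (E := EuclideanSpace ℝ (Fin (m + 1))) (ι := Fin (m + 1)) (by simp) (v := fun _ => u)
      (s := {0}) ⟨fun i => hu, fun i j hij => absurd (Subsingleton.elim i j) hij⟩
    exact ⟨b, hb 0 rfl⟩
  -- Orthonormal coordinates whose first axis is `u`: the reflection becomes `s ↦ -s` with `w`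
  -- fixed, and Fubini reduces the claim to slices parallel to `u`.
  set Φ : ℝ × (Fin m → ℝ) → EuclideanSpace ℝ (Fin (m + 1)) := fun p =>
    b.repr.symm (WithLp.toLp 2 ((MeasurableEquiv.piFinSuccAbove (fun _ => ℝ) 0).symm p)) with hΦ
  have hmp : MeasurePreserving Φ := b.measurePreserving_repr_symm.comp
    ((PiLp.volume_preserving_toLp (Fin (m + 1))).comp
      (volume_preserving_piFinSuccAbove (fun _ : Fin (m + 1) => ℝ) 0).symm)
  have hΦe : ∀ s w, Φ (s, w) = s • u + ∑ i : Fin m, w i • b i.succ := by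
    intro s w
    simp only [hΦ, MeasurableEquiv.piFinSuccAbove, Fin.insertNthEquiv]
    rw [← b.sum_repr_symm, Fin.sum_univ_succ]
    simp [hb]
  have hΦc : ∀ w, Continuous fun s => Φ (s, w) := by
    intro w
    simp only [hΦe]
    fun_prop
  have hrefl : ∀ s w, refl u (Φ (s, w)) = Φ (-s, w) := by
    intro s w
    have h1 : refl u u = -u := Submodule.reflection_orthogonalComplement_singleton_eq_neg u
    have h2 : ∀ i : Fin m, refl u (b i.succ) = b i.succ := by
      intro i
      apply Submodule.reflection_mem_subspace_eq_self
      rw [Submodule.mem_orthogonal_singleton_iff_inner_right, ← hb]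
      exact b.orthonormal.2 (Fin.succ_ne_zero i).symm
    simp only [hΦe, map_add, map_smul, map_sum, h1, h2, smul_neg, neg_smul]
  rw [← hmp.measure_preimage hK.measurableSet.nullMeasurableSet,
    ← hmp.measure_preimage hLm.nullMeasurableSet, Measure.volume_eq_prod,
    Measure.prod_apply_symm (hmp.measurable hK.measurableSet),
    Measure.prod_apply_symm (hmp.measurable hLm)]
  refine lintegral_mono fun w => volume_le_of_symmetrized_slice ?_ ?_ ?_
  · refine Metric.isCompact_of_isClosed_isBounded (hK.isClosed.preimage (hΦc w)) ?_
    obtain ⟨c, hc⟩ := hK.isBounded.exists_norm_le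
    refine (Metric.isBounded_closedBall (x := (0 : ℝ)) (r := c)).subset fun s hs => ?_
    have h1 := hc _ hs
    have h2 : inner ℝ u (Φ (s, w)) = s := by
      rw [hΦe, inner_add_right, inner_smul_right, real_inner_self_eq_norm_sq, hu, inner_sum]
      rw [Finset.sum_eq_zero]
      · simp
      · intro i _
        rw [inner_smul_right, ← hb, b.orthonormal.2 (Fin.succ_ne_zero i).symm, mul_zero]
    have h3 := abs_real_inner_le_norm u (Φ (s, w))
    rw [h2, hu, one_mul] at h3
    simpa using h3.trans h1
  · intro s hs t ht c d hc' hd hcd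
    have := hc hs ht hc' hd hcd
    simp only [Set.mem_preimage] at this ⊢
    convert this using 1
    simp only [hΦe, smul_eq_mul]
    have : (∑ i : Fin m, w i • b i.succ) =
      c • (∑ i : Fin m, w i • b i.succ) + d • (∑ i : Fin m, w i • b i.succ) := by
      rw [← add_smul, hcd, one_smul]
    nth_rw 1 [this]
    module
  · intro s hs s' hs'
    have := hL _ hs _ hs'
    rw [hrefl] at this
    simp only [Set.mem_preimage]
    convert this using 1
    simp only [hΦe]
    module

lemma IsConvC.isCompact_sublevel (h : IsConvC ψ) (t : ℝ) : IsCompact {x | ψ x ≤ (t : EReal)} := by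
  obtain ⟨a, ha, b, hb⟩ := h.exists_growth
  refine Metric.isCompact_of_isClosed_isBounded (h.lsc.isClosed_preimage _) ?_
  refine (Metric.isBounded_closedBall (x := (0 : EuclideanSpace ℝ (Fin n)))
    (r := (t - b) / a)).subset fun x hx => ?_
  have := (hb x).trans hx
  rw [EReal.coe_le_coe_iff] at this
  rw [mem_closedBall_zero_iff, le_div_iff₀ ha]
  linarith

/-- Minkowski symmetrization does not decrease the total mass. -/
theorem IsConvC.lintegral_le_minkSym (h : IsConvC ψ) {u : EuclideanSpace ℝ (Fin n)}
    (hu : ‖u‖ = 1) : ∫⁻ x, EReal.exp (-ψ x) ≤ ∫⁻ x, EReal.exp (-HypoSym.minkSym u ψ x) := by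
  -- Layer cake; the superlevel set at height `t > 0` is the compact convex sublevel set of `φ` at
  -- `-log t`.
  have key : ∀ {φ : EuclideanSpace ℝ (Fin n) → EReal}, IsConvC φ →
      ∫⁻ x, EReal.exp (-φ x) = ∫⁻ t in Set.Ioi 0, volume {x | t ≤ expNeg φ x} := by
    intro φ hφ
    rw [← lintegral_eq_lintegral_meas_le (f := expNeg φ) _
      (Eventually.of_forall fun x => ENNReal.toReal_nonneg)
      hφ.measurable_exp_neg.ennreal_toReal.aemeasurable]
    exact lintegral_congr fun x => (ENNReal.ofReal_toReal (hφ.exp_neg_ne_top x)).symm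
  rw [key h, key (h.minkSym u)]
  refine setLIntegral_mono' measurableSet_Ioi fun t ht => ?_
  simp only [h.le_expNeg_iff _ ht, (h.minkSym u).le_expNeg_iff _ ht]
  refine volume_le_of_mean_refl hu (h.isCompact_sublevel _) ?_
    ((h.minkSym u).isCompact_sublevel _).measurableSet ?_
  · intro x hx y hy c d hc hd hcd
    have := h.convex.combo hx hy hc hd hcd
    rwa [← add_mul, hcd, one_mul] at this
  · intro y hy z hz
    have := minkSym_le u hy hz
    rwa [add_self_div_two] at this

/-- Only the liminf half of epi-convergence, along constant sequences, is needed; the common growth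
bound supplies the majorant for the reverse Fatou lemma. -/
theorem IsEpiSymmetrization.totalMass_le {φ : EuclideanSpace ℝ (Fin n) → EReal} (h : IsConvC ψ)
    (hs : IsEpiSymmetrization ψ φ) : totalMass (expNeg ψ) ≤ totalMass (expNeg φ) := by
  obtain ⟨u, hu, hlim⟩ := hs.epiLimit
  rw [h.totalMass_expNeg, hs.isConvC.totalMass_expNeg]
  refine ENNReal.toReal_mono hs.isConvC.lintegral_exp_neg_ne_top ?_
  obtain ⟨a, ha, b, hb⟩ := h.exists_growth
  have hmono : ∀ m, ∫⁻ x, EReal.exp (-ψ x) ≤ ∫⁻ x, EReal.exp (-iterMinkSym u ψ m x) := by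
    intro m
    induction m with
    | zero => exact le_rfl
    | succ m ih => exact ih.trans ((h.iterMinkSym u m).lintegral_le_minkSym (hu m))
  calc ∫⁻ x, EReal.exp (-ψ x)
      ≤ limsup (fun m => ∫⁻ x, EReal.exp (-iterMinkSym u ψ m x)) atTop :=
        le_limsup_of_frequently_le (Eventually.of_forall hmono).frequently
    _ ≤ ∫⁻ x, limsup (fun m => EReal.exp (-iterMinkSym u ψ m x)) atTop :=
        limsup_lintegral_le (fun x => ENNReal.ofReal (Real.exp (-(a * ‖x‖ + b))))
          (fun m => (h.iterMinkSym u m).measurable_exp_neg)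
          (fun m => Eventually.of_forall fun x =>
            expNeg_le_of_le (h.growth_iterMinkSym u ha.le hb m x))
          (integrable_exp_neg_norm ha b).lintegral_lt_top.ne
    _ ≤ ∫⁻ x, EReal.exp (-φ x) := by
        refine lintegral_mono fun x => ?_
        have hx := (hlim x).1 (fun _ => x) tendsto_const_nhds
        have e : limsup (fun m => EReal.exp (-iterMinkSym u ψ m x)) atTop =
            EReal.exp (-liminf (fun m => iterMinkSym u ψ m x) atTop) := by
          rw [← EReal.limsup_neg]
          exact (EReal.exp_monotone.map_limsup_of_continuousAt _
            ENNReal.continuous_exp.continuousAt).symm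
        rw [e]
        exact EReal.exp_monotone (EReal.neg_le_neg_iff.2 hx)

end Mass

/-! ### The Legendre conjugate, on which symmetrization acts by averaging. -/

section Dual

variable {n : ℕ} {ψ : EuclideanSpace ℝ (Fin n) → EReal}

/-- The values `⟨p, y⟩ - s` over the epigraph of `ψ`. -/
def dualValues (ψ : EuclideanSpace ℝ (Fin n) → EReal) (p : EuclideanSpace ℝ (Fin n)) : Set ℝ :=
  {c | ∃ (y : EuclideanSpace ℝ (Fin n)) (s : ℝ), ψ y ≤ s ∧ c = inner ℝ p y - s}

/-- The effective domain of the Legendre conjugate of `ψ`. -/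
def dualDom (ψ : EuclideanSpace ℝ (Fin n) → EReal) : Set (EuclideanSpace ℝ (Fin n)) :=
  {p | BddAbove (dualValues ψ p)}

/-- The Legendre conjugate of `ψ`, meaningful on `dualDom ψ`. -/
def dual (ψ : EuclideanSpace ℝ (Fin n) → EReal) (p : EuclideanSpace ℝ (Fin n)) : ℝ :=
  sSup (dualValues ψ p)

lemma IsConvC.dualValues_nonempty (h : IsConvC ψ) (p : EuclideanSpace ℝ (Fin n)) :
    (dualValues ψ p).Nonempty := by
  obtain ⟨x, hx⟩ := h.dom_nonempty
  obtain ⟨s, hs⟩ := exists_coe_of_lt_top h.ne_bot hx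
  exact ⟨_, x, s, hs.le, rfl⟩

lemma inner_sub_le_dual {p y : EuclideanSpace ℝ (Fin n)} {s : ℝ} (hp : p ∈ dualDom ψ)
    (hy : ψ y ≤ s) : inner ℝ p y - s ≤ dual ψ p :=
  le_csSup hp ⟨y, s, hy, rfl⟩

lemma mem_dualDom_of_le {p : EuclideanSpace ℝ (Fin n)} {c : ℝ}
    (hc : ∀ (y : EuclideanSpace ℝ (Fin n)) (s : ℝ), ψ y ≤ s → inner ℝ p y - s ≤ c) :
    p ∈ dualDom ψ :=
  ⟨c, by rintro _ ⟨y, s, hy, rfl⟩; exact hc y s hy⟩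

lemma IsConvC.dual_le (h : IsConvC ψ) {p : EuclideanSpace ℝ (Fin n)} {c : ℝ}
    (hc : ∀ (y : EuclideanSpace ℝ (Fin n)) (s : ℝ), ψ y ≤ s → inner ℝ p y - s ≤ c) :
    dual ψ p ≤ c :=
  csSup_le (h.dualValues_nonempty p) (by rintro _ ⟨y, s, hy, rfl⟩; exact hc y s hy)

lemma IsConvC.convexOn_dual (h : IsConvC ψ) : ConvexOn ℝ (dualDom ψ) (dual ψ) := by
  have key : ∀ p ∈ dualDom ψ, ∀ q ∈ dualDom ψ, ∀ a b : ℝ, 0 ≤ a → 0 ≤ b → a + b = 1 →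
      ∀ (y : EuclideanSpace ℝ (Fin n)) (s : ℝ), ψ y ≤ s →
        inner ℝ (a • p + b • q) y - s ≤ a • dual ψ p + b • dual ψ q := by
    intro p hp q hq a b ha hb hab y s hy
    have h1 := mul_le_mul_of_nonneg_left (inner_sub_le_dual hp hy) ha
    have h2 := mul_le_mul_of_nonneg_left (inner_sub_le_dual hq hy) hb
    have h3 : s = a * s + b * s := by rw [← add_mul, hab, one_mul]
    rw [inner_add_left, real_inner_smul_left, real_inner_smul_left, smul_eq_mul, smul_eq_mul]
    linarith
  exact ⟨fun p hp q hq a b ha hb hab => mem_dualDom_of_le (key p hp q hq a b ha hb hab),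
    fun p hp q hq a b ha hb hab => h.dual_le (key p hp q hq a b ha hb hab)⟩

lemma closedBall_subset_dualDom {a b : ℝ}
    (hb : ∀ x, ((a * ‖x‖ + b : ℝ) : EReal) ≤ ψ x) :
    Metric.closedBall 0 a ⊆ dualDom ψ := by
  intro p hp
  rw [mem_closedBall_zero_iff] at hp
  refine mem_dualDom_of_le (c := -b) fun y s hy => ?_
  have h1 := (hb y).trans hy
  rw [EReal.coe_le_coe_iff] at h1
  have h2 := real_inner_le_norm p y
  have h3 := mul_le_mul_of_nonneg_right hp (norm_nonneg y)
  linarith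

/-- Self-adjointness of the reflection moves it from the point onto the slope; this is what turns
Minkowski means into means of conjugates. -/
lemma inner_mean (u p y z : EuclideanSpace ℝ (Fin n)) (r s : ℝ) :
    inner ℝ p ((1 / 2 : ℝ) • (y + refl u z)) - (r + s) / 2 =
      ((inner ℝ p y - r) + (inner ℝ (refl u p) z - s)) / 2 := by
  rw [real_inner_smul_right, inner_add_right, inner_refl_right]
  ring

theorem IsConvC.mem_dualDom_minkSym (h : IsConvC ψ) (u : EuclideanSpace ℝ (Fin n))
    {p : EuclideanSpace ℝ (Fin n)} :
    p ∈ dualDom (HypoSym.minkSym u ψ) ↔ p ∈ dualDom ψ ∧ refl u p ∈ dualDom ψ := by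
  constructor
  · rintro ⟨c, hc⟩
    have hc' : ∀ (y z : EuclideanSpace ℝ (Fin n)) (r s : ℝ), ψ y ≤ r → ψ z ≤ s →
        ((inner ℝ p y - r) + (inner ℝ (refl u p) z - s)) / 2 ≤ c := fun y z r s hy hz =>
      hc ⟨_, _, minkSym_le u hy hz, (inner_mean u p y z r s).symm⟩
    -- Freezing one slot at a point of the effective domain turns the bound on the sum into a bound
    -- on the other summand.
    obtain ⟨x, hx⟩ := h.dom_nonempty
    obtain ⟨t, ht⟩ := exists_coe_of_lt_top h.ne_bot hx
    refine ⟨mem_dualDom_of_le (c := 2 * c - (inner ℝ (refl u p) x - t)) fun y s hy => ?_,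
      mem_dualDom_of_le (c := 2 * c - (inner ℝ p x - t)) fun y s hy => ?_⟩
    · linarith [hc' y x s t hy ht.le]
    · linarith [hc' x y t s ht.le hy]
  · rintro ⟨h1, h2⟩
    refine mem_dualDom_of_le (c := (dual ψ p + dual ψ (refl u p)) / 2) fun x t hx => ?_
    obtain ⟨y, z, r, s, hy, hz, rfl, rfl⟩ := (h.minkSym_le_iff u).1 hx
    rw [inner_mean]
    linarith [inner_sub_le_dual h1 hy, inner_sub_le_dual h2 hz]

theorem IsConvC.dual_minkSym (h : IsConvC ψ) (u : EuclideanSpace ℝ (Fin n))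
    {p : EuclideanSpace ℝ (Fin n)} (h1 : p ∈ dualDom ψ) (h2 : refl u p ∈ dualDom ψ) :
    dual (HypoSym.minkSym u ψ) p = (dual ψ p + dual ψ (refl u p)) / 2 := by
  apply le_antisymm
  · refine (h.minkSym u).dual_le fun x t hx => ?_
    obtain ⟨y, z, r, s, hy, hz, rfl, rfl⟩ := (h.minkSym_le_iff u).1 hx
    rw [inner_mean]
    linarith [inner_sub_le_dual h1 hy, inner_sub_le_dual h2 hz]
  · have hp := (h.mem_dualDom_minkSym u).2 ⟨h1, h2⟩
    have key : ∀ (y z : EuclideanSpace ℝ (Fin n)) (r s : ℝ), ψ y ≤ r → ψ z ≤ s →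
        (inner ℝ p y - r) + (inner ℝ (refl u p) z - s) ≤ 2 * dual (HypoSym.minkSym u ψ) p := by
      intro y z r s hy hz
      have := inner_sub_le_dual hp (minkSym_le u hy hz)
      rw [inner_mean] at this
      linarith
    -- The two slots vary independently, so the suprema are taken one after the other.
    have key2 : ∀ (z : EuclideanSpace ℝ (Fin n)) (s : ℝ), ψ z ≤ s →
        dual ψ p ≤ 2 * dual (HypoSym.minkSym u ψ) p - (inner ℝ (refl u p) z - s) :=
      fun z s hz => h.dual_le fun y r hy => by linarith [key y z r s hy hz]
    have key3 : dual ψ (refl u p) ≤ 2 * dual (HypoSym.minkSym u ψ) p - dual ψ p :=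
      h.dual_le fun z s hz => by linarith [key2 z s hz]
    linarith

lemma IsConvC.ball_subset_dualDom_minkSym (h : IsConvC ψ) (u : EuclideanSpace ℝ (Fin n)) {ρ : ℝ}
    (hρ : Metric.ball 0 ρ ⊆ dualDom ψ) : Metric.ball 0 ρ ⊆ dualDom (HypoSym.minkSym u ψ) := by
  intro p hp
  refine (h.mem_dualDom_minkSym u).2 ⟨hρ hp, hρ ?_⟩
  simpa using hp

end Dual

/-! ### Choosing reflections that round off the conjugate and its domain. -/

section Directions

variable {n : ℕ} {ψ : EuclideanSpace ℝ (Fin n) → EReal}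

/-- Successive Minkowski symmetrals in the directions of a list. -/
def listMinkSym (us : List (EuclideanSpace ℝ (Fin n))) (ψ : EuclideanSpace ℝ (Fin n) → EReal) :
    EuclideanSpace ℝ (Fin n) → EReal :=
  us.foldl (fun φ u => minkSym u φ) ψ

/-- Successive means of a function with its reflections. -/
def listMean (us : List (EuclideanSpace ℝ (Fin n))) (f : EuclideanSpace ℝ (Fin n) → ℝ) :
    EuclideanSpace ℝ (Fin n) → ℝ :=
  us.foldl (fun g u p => (g p + g (refl u p)) / 2) f

/-- The set of points carried into `U` by one of the partial products of reflections. -/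
def listSpread (us : List (EuclideanSpace ℝ (Fin n))) (U : Set (EuclideanSpace ℝ (Fin n))) :
    Set (EuclideanSpace ℝ (Fin n)) :=
  us.foldl (fun V u => V ∪ refl u ⁻¹' V) U

lemma listMinkSym_append (us vs : List (EuclideanSpace ℝ (Fin n))) :
    listMinkSym (us ++ vs) ψ = listMinkSym vs (listMinkSym us ψ) := List.foldl_append

lemma listMean_append (us vs : List (EuclideanSpace ℝ (Fin n)))
    (f : EuclideanSpace ℝ (Fin n) → ℝ) :
    listMean (us ++ vs) f = listMean vs (listMean us f) := List.foldl_append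

/-- A property preserved by every Minkowski symmetrization is preserved by lists of them. -/
lemma listMinkSym_induction {Q : (EuclideanSpace ℝ (Fin n) → EReal) → Prop}
    (hQ : ∀ φ u, Q φ → Q (minkSym u φ)) (us : List (EuclideanSpace ℝ (Fin n))) (h : Q ψ) :
    Q (listMinkSym us ψ) := by
  induction us generalizing ψ with
  | nil => exact h
  | cons u us ih => exact ih (hQ _ u h)

lemma IsConvC.listMinkSym (h : IsConvC ψ) (us : List (EuclideanSpace ℝ (Fin n))) :
    IsConvC (listMinkSym us ψ) :=
  listMinkSym_induction (fun _ u hφ => hφ.minkSym u) us h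

lemma iterMinkSym_eq_listMinkSym (u : ℕ → EuclideanSpace ℝ (Fin n)) (m : ℕ) :
    iterMinkSym u ψ m = listMinkSym ((List.range m).map u) ψ := by
  induction m with
  | zero => rfl
  | succ m ih =>
    rw [List.range_succ, List.map_append, listMinkSym_append, ← ih]
    rfl

/-- The mirror is the bisecting hyperplane of `x` and `p`; when they coincide any unit vector will
do, and `e` provides one. -/
lemma exists_refl_eq {e : EuclideanSpace ℝ (Fin n)} (he : ‖e‖ = 1)
    {p x : EuclideanSpace ℝ (Fin n)} (h : ‖x‖ = ‖p‖) : ∃ u, ‖u‖ = 1 ∧ (refl u x = p ∨ x = p) := by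
  rcases eq_or_ne x p with rfl | hne
  · exact ⟨e, he, Or.inr rfl⟩
  · have h0 : ‖x - p‖ ≠ 0 := norm_ne_zero_iff.2 (sub_ne_zero.2 hne)
    refine ⟨‖x - p‖⁻¹ • (x - p), ?_, Or.inl ?_⟩
    · rw [norm_smul, norm_inv, norm_norm, inv_mul_cancel₀ h0]
    · have hs : Submodule.span ℝ {‖x - p‖⁻¹ • (x - p)} = Submodule.span ℝ {x - p} :=
        Submodule.span_singleton_smul_eq (IsUnit.mk0 _ (inv_ne_zero h0)) _
      simp only [refl, hs]
      exact Submodule.reflection_sub h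

lemma subset_listSpread (us : List (EuclideanSpace ℝ (Fin n)))
    (V : Set (EuclideanSpace ℝ (Fin n))) : V ⊆ listSpread us V := by
  induction us generalizing V with
  | nil => exact subset_rfl
  | cons u us ih => exact Set.subset_union_left.trans (ih _)

/-- Boundedly many reflections carry any cap of given radius over the whole sphere. -/
theorem exists_listSpread_cover {e : EuclideanSpace ℝ (Fin n)} (he : ‖e‖ = 1) (ρ : ℝ) {δ : ℝ}
    (hδ : 0 < δ) : ∃ N : ℕ, ∀ p : EuclideanSpace ℝ (Fin n), ‖p‖ = ρ →
      ∃ us : List (EuclideanSpace ℝ (Fin n)), (∀ u ∈ us, ‖u‖ = 1) ∧ us.length = N ∧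
        ∀ x, ‖x‖ = ρ → x ∈ listSpread us (Metric.ball p δ) := by
  obtain ⟨t, hts, htf, htc⟩ := (isCompact_sphere (0 : EuclideanSpace ℝ (Fin n)) ρ).finite_cover_balls hδ
  -- The bound is the size of a finite `δ`-cover of the sphere, hence independent of `p`. Each
  -- centre gets a reflection carrying its ball onto the ball about `p`.
  refine ⟨htf.toFinset.toList.length, fun p hp => ?_⟩
  have hex : ∀ x : EuclideanSpace ℝ (Fin n), ∃ u, ‖u‖ = 1 ∧ (‖x‖ = ρ → refl u x = p ∨ x = p) := by
    intro x
    by_cases hx : ‖x‖ = ρ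
    · obtain ⟨u, hu, h⟩ := exists_refl_eq he (hx.trans hp.symm)
      exact ⟨u, hu, fun _ => h⟩
    · exact ⟨e, he, fun h => absurd h hx⟩
  choose d hd1 hd2 using hex
  have key : ∀ (l : List (EuclideanSpace ℝ (Fin n))) (V : Set (EuclideanSpace ℝ (Fin n))),
      (∀ x ∈ l, ‖x‖ = ρ) → Metric.ball p δ ⊆ V → ∀ x ∈ l,
        Metric.ball x δ ⊆ listSpread (l.map d) V := by
    intro l
    induction l with
    | nil => intro V _ _ x hx; simp at hx
    | cons z l ih =>
      intro V hl hV x hx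
      have hV' : V ⊆ V ∪ refl (d z) ⁻¹' V := Set.subset_union_left
      rcases List.mem_cons.1 hx with rfl | hx
      · refine subset_trans ?_ (subset_listSpread (l.map d) (V ∪ refl (d x) ⁻¹' V))
        rcases hd2 x (hl x (by simp)) with hr | rfl
        · intro y hy
          right
          apply hV
          rw [Metric.mem_ball, ← hr, LinearIsometryEquiv.dist_map]
          exact hy
        · exact hV.trans hV'
      · exact ih _ (fun w hw => hl w (List.mem_cons_of_mem _ hw)) (hV.trans hV') x hx
  refine ⟨htf.toFinset.toList.map d, ?_, by simp, fun x hx => ?_⟩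
  · intro u hu
    obtain ⟨x, -, rfl⟩ := List.mem_map.1 hu
    exact hd1 x
  · have hx' := htc (show x ∈ Metric.sphere 0 ρ by simpa using hx)
    simp only [Set.mem_iUnion] at hx'
    obtain ⟨z, hz, hxz⟩ := hx'
    refine key _ _ ?_ subset_rfl z (by simpa using hz) hxz
    intro w hw
    have : w ∈ t := by simpa using hw
    simpa using hts this

/-- Averaging a value at most `M - c` with one at most `M` leaves a deficit `c / 2`: each reflection
enlarges the set with a deficit and at worst halves the deficit. -/
lemma listMean_le {ρ M : ℝ} (us : List (EuclideanSpace ℝ (Fin n)))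
    {f : EuclideanSpace ℝ (Fin n) → ℝ} {U : Set (EuclideanSpace ℝ (Fin n))} {c : ℝ} (hc : 0 ≤ c)
    (hM : ∀ x, ‖x‖ = ρ → f x ≤ M) (hU : ∀ x ∈ U, ‖x‖ = ρ → f x ≤ M - c) :
    ∀ x ∈ listSpread us U, ‖x‖ = ρ → listMean us f x ≤ M - c / 2 ^ us.length := by
  induction us generalizing f U c with
  | nil => simpa [listSpread, listMean] using hU
  | cons u us ih =>
    intro x hx hxρ
    have := ih (f := fun p => (f p + f (refl u p)) / 2) (U := U ∪ refl u ⁻¹' U) (c := c / 2)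
      (by linarith) ?_ ?_ x hx hxρ
    · rw [List.length_cons, pow_succ']
      rwa [div_div] at this
    · intro y hy
      linarith [hM y hy, hM (refl u y) (by simpa using hy)]
    · intro y hyU hy
      have h1 := hM y hy
      have h2 := hM (refl u y) (by simpa using hy)
      rcases hyU with hyU | hyU
      · linarith [hU y hyU hy]
      · linarith [hU _ hyU (by simpa using hy)]

lemma le_listMean {ρ m : ℝ} (us : List (EuclideanSpace ℝ (Fin n)))
    {f : EuclideanSpace ℝ (Fin n) → ℝ} (hm : ∀ x, ‖x‖ = ρ → m ≤ f x) :
    ∀ x, ‖x‖ = ρ → m ≤ listMean us f x := by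
  induction us generalizing f with
  | nil => exact hm
  | cons u us ih =>
    refine ih (f := fun p => (f p + f (refl u p)) / 2) fun y hy => ?_
    linarith [hm y hy, hm (refl u y) (by simpa using hy)]

/-- Reflections are isometries, so one `δ`, hence one bound on the number of reflections, serves
every round of averaging. -/
lemma listMean_modulus {ρ δ ε : ℝ} (us : List (EuclideanSpace ℝ (Fin n)))
    {f : EuclideanSpace ℝ (Fin n) → ℝ}
    (hf : ∀ x y, ‖x‖ = ρ → ‖y‖ = ρ → dist x y < δ → f x - f y ≤ ε) :
    ∀ x y, ‖x‖ = ρ → ‖y‖ = ρ → dist x y < δ → listMean us f x - listMean us f y ≤ ε := by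
  induction us generalizing f with
  | nil => exact hf
  | cons u us ih =>
    refine ih (f := fun p => (f p + f (refl u p)) / 2) fun x y hx hy hxy => ?_
    linarith [hf x y hx hy hxy,
      hf (refl u x) (refl u y) (by simpa using hx) (by simpa using hy) (by simpa using hxy)]

/-- Finitely many means with reflections make the oscillation on a sphere arbitrarily small. -/
theorem exists_listMean_osc_le {e : EuclideanSpace ℝ (Fin n)} (he : ‖e‖ = 1) {ρ δ ε m M : ℝ}
    (hδ : 0 < δ) (hε : 0 < ε) {f : EuclideanSpace ℝ (Fin n) → ℝ}
    (hf : ∀ x y, ‖x‖ = ρ → ‖y‖ = ρ → dist x y < δ → f x - f y ≤ ε / 2)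
    (hm : ∀ x, ‖x‖ = ρ → m ≤ f x) (hM : ∀ x, ‖x‖ = ρ → f x ≤ M) :
    ∃ us : List (EuclideanSpace ℝ (Fin n)), (∀ u ∈ us, ‖u‖ = 1) ∧
      ∀ p q, ‖p‖ = ρ → ‖q‖ = ρ → listMean us f p - listMean us f q ≤ ε := by
  -- While the oscillation exceeds `ε`, one round of `N` reflections lowers the upper bound by `η`;
  -- the lower bound `m` stays, so finitely many rounds suffice.
  obtain ⟨N, hN⟩ := exists_listSpread_cover he ρ hδ
  set η : ℝ := ε / 2 / 2 ^ N with hη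
  have hη0 : 0 < η := by positivity
  have key : ∀ (k : ℕ) (f : EuclideanSpace ℝ (Fin n) → ℝ),
      (∀ x y, ‖x‖ = ρ → ‖y‖ = ρ → dist x y < δ → f x - f y ≤ ε / 2) →
      (∀ x, ‖x‖ = ρ → m ≤ f x) → (∀ x, ‖x‖ = ρ → f x ≤ m + k * η) →
      ∃ us : List (EuclideanSpace ℝ (Fin n)), (∀ u ∈ us, ‖u‖ = 1) ∧
        ∀ p q, ‖p‖ = ρ → ‖q‖ = ρ → listMean us f p - listMean us f q ≤ ε := by
    intro k
    induction k with
    | zero =>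
      intro f _ hm hM
      refine ⟨[], by simp, fun p q hp hq => ?_⟩
      have h1 := hM p hp
      have h2 := hm q hq
      simp only [Nat.cast_zero, zero_mul, add_zero] at h1
      simp only [listMean, List.foldl_nil]
      linarith
    | succ k ih =>
      intro f hf hm hM
      by_cases hosc : ∀ p q, ‖p‖ = ρ → ‖q‖ = ρ → f p - f q ≤ ε
      · exact ⟨[], by simp, hosc⟩
      push Not at hosc
      obtain ⟨p, q, hp, hq, hpq⟩ := hosc
      obtain ⟨us, hus, hlen, hcov⟩ := hN q hq
      -- `f q` lies more than `ε` below the upper bound and `f` varies by at most `ε / 2` on the cap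
      -- about `q`, leaving a deficit `ε / 2` there.
      have hle := listMean_le us (f := f) (U := Metric.ball q δ) (c := ε / 2) (by linarith) hM
        (fun x hx hxρ => by linarith [hf x q hxρ hq hx, hM p hp])
      obtain ⟨vs, hvs, hfin⟩ := ih (listMean us f) (listMean_modulus us hf) (le_listMean us hm)
        (fun x hx => by
          have := hle x (hcov x hx) hx
          rw [hlen, ← hη] at this
          push_cast at this
          linarith)
      refine ⟨us ++ vs, ?_, ?_⟩
      · intro u hu
        rcases List.mem_append.1 hu with h | h
        · exact hus u h
        · exact hvs u h
      · rw [listMean_append]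
        exact hfin
  obtain ⟨k, hk⟩ := exists_nat_ge ((M - m) / η)
  rw [div_le_iff₀ hη0] at hk
  exact key k f hf hm fun x hx => by linarith [hM x hx]

lemma IsConvC.dual_listMinkSym (h : IsConvC ψ) {ρ : ℝ} (us : List (EuclideanSpace ℝ (Fin n)))
    (hρ : Metric.ball 0 ρ ⊆ dualDom ψ) {f : EuclideanSpace ℝ (Fin n) → ℝ}
    (hf : Set.EqOn (dual ψ) f (Metric.ball 0 ρ)) :
    Set.EqOn (dual (HypoSym.listMinkSym us ψ)) (listMean us f) (Metric.ball 0 ρ) := by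
  induction us generalizing ψ f with
  | nil => exact hf
  | cons u us ih =>
    refine ih (h.minkSym u) (h.ball_subset_dualDom_minkSym u hρ) fun p hp => ?_
    have hp' : refl u p ∈ Metric.ball 0 ρ := by simpa using hp
    rw [h.dual_minkSym u (hρ hp) (hρ hp'), hf hp, hf hp']

theorem IsConvC.exists_osc_le (h : IsConvC ψ) {e : EuclideanSpace ℝ (Fin n)} (he : ‖e‖ = 1)
    {ρ ρ' ε : ℝ} (hρ : ρ < ρ') (hρ' : Metric.ball 0 ρ' ⊆ dualDom ψ) (hε : 0 < ε) :
    ∃ us : List (EuclideanSpace ℝ (Fin n)), (∀ u ∈ us, ‖u‖ = 1) ∧ ∀ p q, ‖p‖ = ρ → ‖q‖ = ρ →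
      dual (HypoSym.listMinkSym us ψ) p - dual (HypoSym.listMinkSym us ψ) q ≤ ε := by
  have hcont : ContinuousOn (dual ψ) (Metric.ball 0 ρ') :=
    (h.convexOn_dual.subset hρ' (convex_ball _ _)).continuousOn Metric.isOpen_ball
  have hsub : Metric.sphere (0 : EuclideanSpace ℝ (Fin n)) ρ ⊆ Metric.ball 0 ρ' := by
    intro x hx
    simp only [mem_sphere_zero_iff_norm] at hx
    simpa [hx] using hρ
  have hS := isCompact_sphere (0 : EuclideanSpace ℝ (Fin n)) ρ
  obtain ⟨m, hm⟩ := (hS.image_of_continuousOn (hcont.mono hsub)).bddBelow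
  obtain ⟨M, hM⟩ := (hS.image_of_continuousOn (hcont.mono hsub)).bddAbove
  have huc := hS.uniformContinuousOn_of_continuous (hcont.mono hsub)
  obtain ⟨δ, hδ, hmod⟩ := Metric.uniformContinuousOn_iff.1 huc (ε / 2) (by linarith)
  obtain ⟨us, hus, hosc⟩ := exists_listMean_osc_le he hδ hε (f := dual ψ) (ρ := ρ) (m := m) (M := M)
    (fun x y hx hy hxy => by
      have := hmod x (by simpa using hx) y (by simpa using hy) hxy
      rw [Real.dist_eq] at this
      exact (le_abs_self _).trans this.le)
    (fun x hx => hm ⟨x, by simpa using hx, rfl⟩) (fun x hx => hM ⟨x, by simpa using hx, rfl⟩)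
  refine ⟨us, hus, fun p q hp hq => ?_⟩
  have heq := h.dual_listMinkSym us hρ' (f := dual ψ) (fun _ _ => rfl)
  rw [heq (hsub (by simpa using hp)), heq (hsub (by simpa using hq))]
  exact hosc p q hp hq

lemma IsConvC.zero_mem_dualDom (h : IsConvC ψ) : (0 : EuclideanSpace ℝ (Fin n)) ∈ dualDom ψ := by
  obtain ⟨a, ha, b, hb⟩ := h.exists_growth
  exact closedBall_subset_dualDom hb (by simpa using ha.le)

lemma IsConvC.smul_mem_dualDom (h : IsConvC ψ) {p : EuclideanSpace ℝ (Fin n)}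
    (hp : p ∈ dualDom ψ) {l : ℝ} (hl0 : 0 ≤ l) (hl1 : l ≤ 1) : l • p ∈ dualDom ψ := by
  have := h.convexOn_dual.1 h.zero_mem_dualDom hp (sub_nonneg.2 hl1) hl0 (by ring)
  simpa using this

lemma IsConvC.not_mem_dualDom_listSpread (h : IsConvC ψ) {ρ : ℝ}
    (us : List (EuclideanSpace ℝ (Fin n))) {U : Set (EuclideanSpace ℝ (Fin n))}
    (hU : ∀ x ∈ U, ‖x‖ = ρ → x ∉ dualDom ψ) :
    ∀ x ∈ listSpread us U, ‖x‖ = ρ → x ∉ dualDom (HypoSym.listMinkSym us ψ) := by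
  induction us generalizing ψ U with
  | nil => exact hU
  | cons u us ih =>
    refine ih (h.minkSym u) (U := U ∪ refl u ⁻¹' U) fun x hx hxρ hmem => ?_
    obtain ⟨h1, h2⟩ := (h.mem_dualDom_minkSym u).1 hmem
    rcases hx with hx | hx
    · exact hU x hx hxρ h1
    · exact hU _ hx (by simpa using hxρ) h2

/-- Convexity turns the missing point into a missing cap on the sphere of radius `ρ`, reflections
spread the cap over this sphere, and star-shapedness about the origin excludes everything beyond. -/
theorem IsConvC.exists_dualDom_disjoint (h : IsConvC ψ) {e : EuclideanSpace ℝ (Fin n)}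
    (he : ‖e‖ = 1) {ρ : ℝ} {p₀ : EuclideanSpace ℝ (Fin n)} (hp₀ : p₀ ∉ dualDom ψ)
    (hρ : ‖p₀‖ < ρ) : ∃ us : List (EuclideanSpace ℝ (Fin n)), (∀ u ∈ us, ‖u‖ = 1) ∧
      ∀ p, ρ ≤ ‖p‖ → p ∉ dualDom (HypoSym.listMinkSym us ψ) := by
  obtain ⟨a, ha, b, hb⟩ := h.exists_growth
  have hball := closedBall_subset_dualDom hb
  have hp0 : 0 < ‖p₀‖ := by
    rw [norm_pos_iff]
    rintro rfl
    exact hp₀ h.zero_mem_dualDom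
  have hρ0 : 0 < ρ := hp0.trans hρ
  set l : ℝ := ‖p₀‖ / ρ with hl
  have hl0 : 0 < l := by positivity
  have hl1 : l < 1 := by rw [hl, div_lt_one hρ0]; exact hρ
  set q₀ : EuclideanSpace ℝ (Fin n) := l⁻¹ • p₀ with hq₀
  have hq₀n : ‖q₀‖ = ρ := by
    rw [hq₀, norm_smul, norm_inv, Real.norm_of_nonneg hl0.le, hl]
    field_simp
  have hcap : ∀ q ∈ Metric.ball q₀ (a * (1 - l)), ‖q‖ = ρ → q ∉ dualDom ψ := by
    intro q hq _ hmem
    apply hp₀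
    -- Chosen so that `p₀ = l • q + (1 - l) • w`; the cap radius `a * (1 - l)` keeps `w` in the ball
    -- of radius `a` inside the domain.
    set w : EuclideanSpace ℝ (Fin n) := (l * (1 - l)⁻¹) • (q₀ - q) with hw
    have h1l : 0 < 1 - l := by linarith
    have hwm : w ∈ dualDom ψ := by
      apply hball
      rw [mem_closedBall_zero_iff, hw, norm_smul, Real.norm_of_nonneg (by positivity),
        ← dist_eq_norm, dist_comm]
      rw [Metric.mem_ball] at hq
      calc l * (1 - l)⁻¹ * dist q q₀ ≤ 1 * (1 - l)⁻¹ * (a * (1 - l)) := by gcongr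
        _ = a := by field_simp
    have := h.convexOn_dual.1 hmem hwm hl0.le h1l.le (by ring)
    convert this using 1
    have e1 : (1 - l) • w = l • (q₀ - q) := by
      rw [hw, smul_smul]; congr 1; field_simp
    have e2 : l • q₀ = p₀ := by rw [hq₀, smul_smul, mul_inv_cancel₀ hl0.ne', one_smul]
    rw [e1, smul_sub, e2]
    abel
  obtain ⟨N, hN⟩ := exists_listSpread_cover he ρ (δ := a * (1 - l))
    (mul_pos ha (by linarith))
  obtain ⟨us, hus, -, hcov⟩ := hN q₀ hq₀n
  refine ⟨us, hus, fun p hp hmem => ?_⟩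
  have hpp : 0 < ‖p‖ := hρ0.trans_le hp
  have hsp : ‖(ρ / ‖p‖) • p‖ = ρ := by
    rw [norm_smul, Real.norm_of_nonneg (by positivity)]
    field_simp
  exact h.not_mem_dualDom_listSpread us hcap _ (hcov _ hsp) hsp
    ((h.listMinkSym us).smul_mem_dualDom hmem (by positivity) ((div_le_one hpp).2 hp))

/-- Countably many goals, each attainable by finitely many symmetrizations from any stage, are
attained along a single sequence of directions. -/
theorem exists_directions {ι : Type*} [Countable ι] [Nonempty ι] {e : EuclideanSpace ℝ (Fin n)}
    (he : ‖e‖ = 1) (Q : ι → (EuclideanSpace ℝ (Fin n) → EReal) → Prop)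
    (hQ : ∀ i (us : List (EuclideanSpace ℝ (Fin n))), ∃ vs : List (EuclideanSpace ℝ (Fin n)),
      (∀ v ∈ vs, ‖v‖ = 1) ∧ Q i (listMinkSym vs (listMinkSym us ψ))) :
    ∃ u : ℕ → EuclideanSpace ℝ (Fin n), (∀ i, ‖u i‖ = 1) ∧
      ∀ i, ∃ m, Q i (iterMinkSym u ψ m) := by
  obtain ⟨g, hg⟩ := exists_surjective_nat ι
  choose ext hext1 hext2 using hQ
  -- Nested prefixes, stage `k` attaining goal `g k`. The extra `e` forces the lengths to grow even
  -- when a goal needs no reflection, so that the sequence is infinite.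
  let P : ℕ → List (EuclideanSpace ℝ (Fin n)) := fun k =>
    Nat.rec [] (fun k l => (l ++ [e]) ++ ext (g k) (l ++ [e])) k
  have hPs : ∀ k, P (k + 1) = (P k ++ [e]) ++ ext (g k) (P k ++ [e]) := fun k => rfl
  have hunit : ∀ k, ∀ u ∈ P k, ‖u‖ = 1 := by
    intro k
    induction k with
    | zero => intro u hu; simp [P] at hu
    | succ k ih =>
      intro u hu
      rw [hPs, List.mem_append, List.mem_append, List.mem_singleton] at hu
      rcases hu with (hu | rfl) | hu
      · exact ih u hu
      · exact he
      · exact hext1 _ _ u hu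
  have hlen : ∀ k, k ≤ (P k).length := by
    intro k
    induction k with
    | zero => simp
    | succ k ih =>
      rw [hPs]
      simp only [List.length_append, List.length_singleton]
      omega
  have hpre : ∀ k l, k ≤ l → P k <+: P l := by
    intro k l hkl
    induction l, hkl using Nat.le_induction with
    | base => exact List.prefix_rfl
    | succ l _ ih =>
      refine ih.trans ?_
      rw [hPs, List.append_assoc]
      exact List.prefix_append _ _
  refine ⟨fun i => (P (i + 1))[i]'(hlen (i + 1)), fun i => hunit (i + 1) _ (List.getElem_mem (hlen (i + 1))),
    fun i => ?_⟩
  obtain ⟨k, rfl⟩ := hg i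
  refine ⟨(P (k + 1)).length, ?_⟩
  rw [iterMinkSym_eq_listMinkSym]
  have : (List.range (P (k + 1)).length).map (fun i => (P (i + 1))[i]'(hlen (i + 1))) =
      P (k + 1) := by
    refine List.ext_getElem (by simp) fun i h1 h2 => ?_
    simp only [List.getElem_map, List.getElem_range]
    rcases le_total (i + 1) (k + 1) with hik | hik
    · exact (hpre _ _ hik).getElem _
    · exact ((hpre _ _ hik).getElem _).symm
  rw [this, hPs, listMinkSym_append]
  exact hext2 _ _

/-- There are directions along which the conjugates become asymptotically constant on every
sphere of rational radius inside the domain of the conjugate, and infinite outside. -/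
theorem IsConvC.exists_symmetrizing_directions (h : IsConvC ψ) {e : EuclideanSpace ℝ (Fin n)}
    (he : ‖e‖ = 1) : ∃ u : ℕ → EuclideanSpace ℝ (Fin n), (∀ i, ‖u i‖ = 1) ∧
      (∀ (ρ : ℚ) (ρ' ε : ℝ), (ρ : ℝ) < ρ' → Metric.ball 0 ρ' ⊆ dualDom ψ → 0 < ε →
        ∀ᶠ m in atTop, ∀ p q, ‖p‖ = ρ → ‖q‖ = ρ →
          dual (HypoSym.iterMinkSym u ψ m) p - dual (HypoSym.iterMinkSym u ψ m) q ≤ ε) ∧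
      ∀ (ρ : ℚ) (p₀), p₀ ∉ dualDom ψ → ‖p₀‖ < ρ →
        ∀ᶠ m in atTop, ∀ p, (ρ : ℝ) ≤ ‖p‖ → p ∉ dualDom (HypoSym.iterMinkSym u ψ m) := by
  let Q : ℚ × ℕ → (EuclideanSpace ℝ (Fin n) → EReal) → Prop := fun i φ =>
    ((∃ ρ' : ℝ, (i.1 : ℝ) < ρ' ∧ Metric.ball 0 ρ' ⊆ dualDom ψ) →
      ∀ p q, ‖p‖ = i.1 → ‖q‖ = i.1 → dual φ p - dual φ q ≤ 1 / ((i.2 : ℝ) + 1)) ∧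
    ((∃ p₀, p₀ ∉ dualDom ψ ∧ ‖p₀‖ < i.1) → ∀ p, (i.1 : ℝ) ≤ ‖p‖ → p ∉ dualDom φ)
  have hatt : ∀ i (us : List (EuclideanSpace ℝ (Fin n))), ∃ vs : List (EuclideanSpace ℝ (Fin n)),
      (∀ v ∈ vs, ‖v‖ = 1) ∧ Q i (HypoSym.listMinkSym vs (HypoSym.listMinkSym us ψ)) := by
    rintro ⟨ρ, j⟩ us
    have hφ := h.listMinkSym us
    by_cases hgood : ∃ ρ' : ℝ, (ρ : ℝ) < ρ' ∧ Metric.ball 0 ρ' ⊆ dualDom ψ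
    · obtain ⟨ρ', hρ, hρ'⟩ := hgood
      have hball : IsConvC (HypoSym.listMinkSym us ψ) ∧
          Metric.ball 0 ρ' ⊆ dualDom (HypoSym.listMinkSym us ψ) :=
        listMinkSym_induction (Q := fun φ => IsConvC φ ∧ Metric.ball 0 ρ' ⊆ dualDom φ)
          (fun φ u hh => ⟨hh.1.minkSym u, hh.1.ball_subset_dualDom_minkSym u hh.2⟩) us ⟨h, hρ'⟩
      obtain ⟨vs, hvs, hosc⟩ := hφ.exists_osc_le he hρ hball.2
        (ε := 1 / ((j : ℝ) + 1)) (by positivity)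
      refine ⟨vs, hvs, fun _ => hosc, ?_⟩
      rintro ⟨p₀, hp₀, hlt⟩
      exact absurd (hρ' (by simpa using hlt.trans hρ)) hp₀
    by_cases hbad : ∃ p₀, p₀ ∉ dualDom ψ ∧ ‖p₀‖ < ρ
    · obtain ⟨p₀, hp₀, hlt⟩ := hbad
      have hnot : IsConvC (HypoSym.listMinkSym us ψ) ∧ p₀ ∉ dualDom (HypoSym.listMinkSym us ψ) :=
        listMinkSym_induction (Q := fun φ => IsConvC φ ∧ p₀ ∉ dualDom φ)
          (fun φ u hh => ⟨hh.1.minkSym u,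
            fun hmem => hh.2 ((hh.1.mem_dualDom_minkSym u).1 hmem).1⟩) us ⟨h, hp₀⟩
      obtain ⟨vs, hvs, hdis⟩ := hφ.exists_dualDom_disjoint he hnot.2 hlt
      exact ⟨vs, hvs, fun hg => absurd hg hgood, fun _ => hdis⟩
    -- Here `ρ` is exactly the inradius of the domain, and both goals are vacuous.
    · exact ⟨[], by simp, fun hg => absurd hg hgood, fun hb => absurd hb hbad⟩
  obtain ⟨u, hu, hQ⟩ := exists_directions he Q hatt
  refine ⟨u, hu, fun ρ ρ' ε hρ hρ' hε => ?_, fun ρ p₀ hp₀ hρ => ?_⟩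
  · obtain ⟨j, hj⟩ := exists_nat_one_div_lt hε
    obtain ⟨m₀, hm₀, -⟩ := hQ (ρ, j)
    have hm₀' := hm₀ ⟨ρ', hρ, hρ'⟩
    have hball : ∀ m, Metric.ball 0 ρ' ⊆ dualDom (HypoSym.iterMinkSym u ψ m) := by
      intro m
      induction m with
      | zero => exact hρ'
      | succ m ih => exact (h.iterMinkSym u m).ball_subset_dualDom_minkSym _ ih
    -- A goal once attained persists: averaging over a reflection cannot increase the oscillation on
    -- a sphere.
    filter_upwards [eventually_ge_atTop m₀] with m hm
    induction m, hm using Nat.le_induction with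
    | base => exact fun p q hp hq => (hm₀' p q hp hq).trans hj.le
    | succ m _ ih =>
      intro p q hp hq
      have hmem : ∀ r : EuclideanSpace ℝ (Fin n), ‖r‖ = ρ →
          r ∈ dualDom (HypoSym.iterMinkSym u ψ m) := fun r hr => hball m (by simpa [hr] using hρ)
      have hp' : ‖refl (u m) p‖ = ρ := by simpa using hp
      have hq' : ‖refl (u m) q‖ = ρ := by simpa using hq
      change dual (HypoSym.minkSym (u m) _) p - dual (HypoSym.minkSym (u m) _) q ≤ ε
      rw [(h.iterMinkSym u m).dual_minkSym (u m) (hmem p hp) (hmem _ hp'),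
        (h.iterMinkSym u m).dual_minkSym (u m) (hmem q hq) (hmem _ hq')]
      linarith [ih p q hp hq, ih _ _ hp' hq']
  · obtain ⟨m₀, -, hm₀⟩ := hQ (ρ, 0)
    have hm₀' := hm₀ ⟨p₀, hp₀, hρ⟩
    filter_upwards [eventually_ge_atTop m₀] with m hm
    induction m, hm using Nat.le_induction with
    | base => exact hm₀'
    | succ m _ ih =>
      intro p hp hmem
      exact ih p hp (((h.iterMinkSym u m).mem_dualDom_minkSym (u m)).1 hmem).1

end Directions

/-! ### Locally uniform convergence of the conjugates to a radial function. -/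

section DualLimit

variable {n : ℕ} {ψ : EuclideanSpace ℝ (Fin n) → EReal} {u : ℕ → EuclideanSpace ℝ (Fin n)}

/-- The largest open ball about the origin in the domain of the conjugate of `ψ`. -/
def dualInball (ψ : EuclideanSpace ℝ (Fin n) → EReal) : Set (EuclideanSpace ℝ (Fin n)) :=
  {p | ∃ ρ : ℝ, ‖p‖ < ρ ∧ Metric.ball 0 ρ ⊆ dualDom ψ}

/-- The conjugates of the successive symmetrals converge, uniformly on closed balls in the
domain, to the radial function `α`. -/
structure IsDualLimit (u : ℕ → EuclideanSpace ℝ (Fin n)) (ψ : EuclideanSpace ℝ (Fin n) → EReal)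
    (α : EuclideanSpace ℝ (Fin n) → ℝ) : Prop where
  uniform : ∀ r ρ ε : ℝ, r < ρ → Metric.ball 0 ρ ⊆ dualDom ψ → 0 < ε →
    ∀ᶠ m in atTop, ∀ p, ‖p‖ ≤ r → |dual (iterMinkSym u ψ m) p - α p| ≤ ε
  radial : ∀ p ∈ dualInball ψ, ∀ q, ‖q‖ = ‖p‖ → α p = α q

lemma IsConvC.ball_subset_dualDom_iterMinkSym (h : IsConvC ψ)
    (u : ℕ → EuclideanSpace ℝ (Fin n)) {ρ : ℝ} (hρ : Metric.ball 0 ρ ⊆ dualDom ψ) (m : ℕ) :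
    Metric.ball 0 ρ ⊆ dualDom (HypoSym.iterMinkSym u ψ m) := by
  induction m with
  | zero => exact hρ
  | succ m ih => exact (h.iterMinkSym u m).ball_subset_dualDom_minkSym _ ih

lemma IsConvC.dual_iterMinkSym_succ (h : IsConvC ψ) (u : ℕ → EuclideanSpace ℝ (Fin n)) {ρ : ℝ}
    (hρ : Metric.ball 0 ρ ⊆ dualDom ψ) (m : ℕ) {p : EuclideanSpace ℝ (Fin n)} (hp : ‖p‖ < ρ) :
    dual (HypoSym.iterMinkSym u ψ (m + 1)) p =
      (dual (HypoSym.iterMinkSym u ψ m) p + dual (HypoSym.iterMinkSym u ψ m) (refl (u m) p)) / 2 := by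
  have hb := h.ball_subset_dualDom_iterMinkSym u hρ m
  exact (h.iterMinkSym u m).dual_minkSym (u m) (hb (by simpa using hp)) (hb (by simpa using hp))

lemma IsConvC.dual_iterMinkSym_modulus (h : IsConvC ψ) (u : ℕ → EuclideanSpace ℝ (Fin n))
    {r ρ ε : ℝ} (hr : r < ρ) (hρ : Metric.ball 0 ρ ⊆ dualDom ψ) (hε : 0 < ε) :
    ∃ δ > 0, ∀ m p q, ‖p‖ ≤ r → ‖q‖ ≤ r → dist p q < δ →
      dual (HypoSym.iterMinkSym u ψ m) p - dual (HypoSym.iterMinkSym u ψ m) q ≤ ε := by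
  have hcont : ContinuousOn (dual ψ) (Metric.closedBall 0 r) :=
    ((h.convexOn_dual.subset hρ (convex_ball _ _)).continuousOn Metric.isOpen_ball).mono
      (Metric.closedBall_subset_ball hr)
  have huc := (isCompact_closedBall (0 : EuclideanSpace ℝ (Fin n)) r).uniformContinuousOn_of_continuous
    hcont
  obtain ⟨δ, hδ, hmod⟩ := Metric.uniformContinuousOn_iff.1 huc ε hε
  refine ⟨δ, hδ, fun m => ?_⟩
  induction m with
  | zero =>
    intro p q hp hq hpq
    have := hmod p (by simpa using hp) q (by simpa using hq) hpq
    rw [Real.dist_eq] at this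
    exact (le_abs_self _).trans this.le
  | succ m ih =>
    intro p q hp hq hpq
    rw [h.dual_iterMinkSym_succ u hρ m (hp.trans_lt hr), h.dual_iterMinkSym_succ u hρ m (hq.trans_lt hr)]
    linarith [ih p q hp hq hpq, ih (refl (u m) p) (refl (u m) q) (by simpa using hp)
      (by simpa using hq) (by simpa using hpq)]

/-- The spheres of radius `κ * i` up to `r` are finitely many, and equicontinuity of the conjugates
transfers the bound from them to all intermediate radii. -/
lemma IsConvC.eventually_osc_le (h : IsConvC ψ)
    (hosc : ∀ (ρ : ℚ) (ρ' ε : ℝ), (ρ : ℝ) < ρ' → Metric.ball 0 ρ' ⊆ dualDom ψ → 0 < ε →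
        ∀ᶠ m in atTop, ∀ p q, ‖p‖ = ρ → ‖q‖ = ρ →
          dual (HypoSym.iterMinkSym u ψ m) p - dual (HypoSym.iterMinkSym u ψ m) q ≤ ε)
    {r ρ ε : ℝ} (hr : r < ρ) (hρ : Metric.ball 0 ρ ⊆ dualDom ψ) (hε : 0 < ε) :
    ∀ᶠ m in atTop, ∀ p q, ‖p‖ ≤ r → ‖q‖ = ‖p‖ →
      dual (HypoSym.iterMinkSym u ψ m) p - dual (HypoSym.iterMinkSym u ψ m) q ≤ ε := by
  obtain ⟨δ, hδ, hmod⟩ := h.dual_iterMinkSym_modulus u hr hρ (ε := ε / 3) (by linarith)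
  obtain ⟨κ, hκ0, hκδ⟩ := exists_rat_btwn hδ
  obtain ⟨K, hK⟩ := exists_nat_gt (r / κ)
  have hfin : ∀ᶠ m in atTop, ∀ i ∈ Finset.range K, ((κ * i : ℚ) : ℝ) ≤ r → ∀ p q,
      ‖p‖ = ((κ * i : ℚ) : ℝ) → ‖q‖ = ((κ * i : ℚ) : ℝ) →
      dual (HypoSym.iterMinkSym u ψ m) p - dual (HypoSym.iterMinkSym u ψ m) q ≤ ε / 3 := by
    rw [eventually_all_finset]
    intro i _
    by_cases hi : ((κ * i : ℚ) : ℝ) ≤ r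
    · filter_upwards [hosc (κ * i) ρ (ε / 3) (hi.trans_lt hr) hρ (by linarith)] with m hm
      exact fun _ => hm
    · exact Eventually.of_forall fun m hi' => absurd hi' hi
  filter_upwards [hfin] with m hm p q hp hq
  rcases eq_or_ne p 0 with rfl | hp0
  · have : q = 0 := by simpa using hq
    rw [this, sub_self]
    exact hε.le
  have hs : 0 < ‖p‖ := norm_pos_iff.2 hp0
  -- Radial contraction to the sphere of radius `κ * i` moves points by less than `κ < δ`.
  set i := ⌊‖p‖ / κ⌋₊ with hi
  have hi1 : (i : ℝ) ≤ ‖p‖ / κ := Nat.floor_le (by positivity)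
  have hi2 : ‖p‖ / κ < i + 1 := Nat.lt_floor_add_one _
  rw [le_div_iff₀ hκ0] at hi1
  rw [div_lt_iff₀ hκ0] at hi2
  have hiK : i ∈ Finset.range K := by
    rw [Finset.mem_range]
    have h1 : ‖p‖ / κ ≤ r / κ := by gcongr
    have h2 : (i : ℝ) < K := (Nat.floor_le (by positivity)).trans_lt (h1.trans_lt hK)
    exact_mod_cast h2
  have hir : ((κ * i : ℚ) : ℝ) = κ * i := by push_cast; ring
  have hl0 : 0 ≤ (κ * i : ℝ) / ‖p‖ := by positivity
  have near : ∀ w : EuclideanSpace ℝ (Fin n), ‖w‖ = ‖p‖ →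
      ‖((κ * i : ℝ) / ‖p‖) • w‖ = ((κ * i : ℚ) : ℝ) ∧ dist w (((κ * i : ℝ) / ‖p‖) • w) < δ := by
    intro w hw
    constructor
    · rw [norm_smul, Real.norm_of_nonneg hl0, hw, hir]
      field_simp
    · have e : w - ((κ * i : ℝ) / ‖p‖) • w = (1 - (κ * i : ℝ) / ‖p‖) • w := by module
      have hle : (κ * i : ℝ) / ‖p‖ ≤ 1 := by rw [div_le_one hs]; linarith
      rw [dist_eq_norm, e, norm_smul, Real.norm_of_nonneg (by linarith), hw]
      have : (1 - (κ * i : ℝ) / ‖p‖) * ‖p‖ = ‖p‖ - κ * i := by field_simp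
      linarith
  obtain ⟨hp1, hp2⟩ := near p rfl
  obtain ⟨hq1, hq2⟩ := near q hq
  have hile : ((κ * i : ℚ) : ℝ) ≤ r := by rw [hir]; linarith
  have a1 := hmod m p _ hp (hp1.le.trans hile) hp2
  have a2 := hm i hiK hile _ _ hp1 hq1
  have a3 := hmod m _ q (hq1.le.trans hile) (hq.le.trans hp) (by rwa [dist_comm])
  linarith

/-- A later conjugate at `p` is an average of stage-`m` values on the sphere through `p`; hence the
sequence is Cauchy. -/
lemma IsConvC.abs_dual_sub_le (h : IsConvC ψ) {r ρ ε : ℝ} (hr : r < ρ)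
    (hρ : Metric.ball 0 ρ ⊆ dualDom ψ) {m : ℕ}
    (hm : ∀ p q, ‖p‖ ≤ r → ‖q‖ = ‖p‖ →
      dual (HypoSym.iterMinkSym u ψ m) p - dual (HypoSym.iterMinkSym u ψ m) q ≤ ε)
    {k : ℕ} (hk : m ≤ k) : ∀ p q, ‖p‖ ≤ r → ‖q‖ = ‖p‖ →
      |dual (HypoSym.iterMinkSym u ψ k) p - dual (HypoSym.iterMinkSym u ψ m) q| ≤ ε := by
  induction k, hk using Nat.le_induction with
  | base =>
    intro p q hp hq
    rw [abs_le]
    constructor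
    · linarith [hm q p (hq.le.trans hp) hq.symm]
    · exact hm p q hp hq
  | succ k _ ih =>
    intro p q hp hq
    have h1 := abs_le.1 (ih p q hp hq)
    have h2 := abs_le.1 (ih (refl (u k) p) q (by simpa using hp) (by simpa using hq))
    rw [h.dual_iterMinkSym_succ u hρ k (hp.trans_lt hr), abs_le]
    constructor <;> linarith

theorem IsConvC.exists_isDualLimit (h : IsConvC ψ)
    (hosc : ∀ (ρ : ℚ) (ρ' ε : ℝ), (ρ : ℝ) < ρ' → Metric.ball 0 ρ' ⊆ dualDom ψ → 0 < ε →
        ∀ᶠ m in atTop, ∀ p q, ‖p‖ = ρ → ‖q‖ = ρ →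
          dual (HypoSym.iterMinkSym u ψ m) p - dual (HypoSym.iterMinkSym u ψ m) q ≤ ε) :
    ∃ α, IsDualLimit u ψ α := by
  -- Outside `dualInball ψ` the value of `α` is arbitrary and plays no role.
  have hlim : ∀ p : EuclideanSpace ℝ (Fin n), ∃ a : ℝ, p ∈ dualInball ψ →
      Tendsto (fun m => dual (HypoSym.iterMinkSym u ψ m) p) atTop (𝓝 a) := by
    intro p
    by_cases hp : p ∈ dualInball ψ
    · obtain ⟨ρ, hpρ, hρ⟩ := hp
      obtain ⟨a, ha⟩ := cauchySeq_tendsto_of_complete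
        (u := fun m => dual (HypoSym.iterMinkSym u ψ m) p) (by
          rw [Metric.cauchySeq_iff']
          intro ε hε
          obtain ⟨m, hm⟩ := (h.eventually_osc_le hosc hpρ hρ (half_pos hε)).exists
          refine ⟨m, fun k hk => ?_⟩
          rw [Real.dist_eq]
          exact (h.abs_dual_sub_le hpρ hρ hm hk p p le_rfl rfl).trans_lt (half_lt_self hε))
      exact ⟨a, fun _ => ha⟩
    · exact ⟨0, fun hp' => absurd hp' hp⟩
  choose α hα using hlim
  refine ⟨α, ?_, ?_⟩
  · intro r ρ ε hr hρ hε
    filter_upwards [h.eventually_osc_le hosc hr hρ hε] with m hm p hp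
    have ht : Tendsto (fun k => |dual (HypoSym.iterMinkSym u ψ k) p -
        dual (HypoSym.iterMinkSym u ψ m) p|) atTop
        (𝓝 |α p - dual (HypoSym.iterMinkSym u ψ m) p|) :=
      ((hα p ⟨ρ, hp.trans_lt hr, hρ⟩).sub tendsto_const_nhds).abs
    rw [abs_sub_comm]
    refine le_of_tendsto ht ?_
    filter_upwards [eventually_ge_atTop m] with k hk
    exact h.abs_dual_sub_le hr hρ hm hk p p hp rfl
  · rintro p ⟨ρ, hpρ, hρ⟩ q hq
    have hq' : ‖q‖ < ρ := by rwa [hq]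
    have hle : ∀ ε > 0, |α p - α q| ≤ 0 + ε := by
      intro ε hε
      have ht : Tendsto (fun k => |dual (HypoSym.iterMinkSym u ψ k) p -
          dual (HypoSym.iterMinkSym u ψ k) q|) atTop (𝓝 |α p - α q|) :=
        ((hα p ⟨ρ, hpρ, hρ⟩).sub (hα q ⟨ρ, hq', hρ⟩)).abs
      refine le_of_tendsto ht ?_
      filter_upwards [h.eventually_osc_le hosc hpρ hρ hε] with k hk
      rw [zero_add, abs_le]
      constructor
      · linarith [hk q p hq.le hq.symm]
      · exact hk p q le_rfl hq
    have := abs_eq_zero.1 (le_antisymm (le_of_forall_pos_le_add hle) (abs_nonneg _))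
    linarith

lemma IsDualLimit.tendsto {α : EuclideanSpace ℝ (Fin n) → ℝ} (hα : IsDualLimit u ψ α)
    {p : EuclideanSpace ℝ (Fin n)} (hp : p ∈ dualInball ψ) :
    Tendsto (fun m => dual (iterMinkSym u ψ m) p) atTop (𝓝 (α p)) := by
  obtain ⟨ρ, hpρ, hρ⟩ := hp
  rw [Metric.tendsto_atTop]
  intro ε hε
  obtain ⟨N, hN⟩ := eventually_atTop.1 (hα.uniform _ _ _ hpρ hρ (half_pos hε))
  refine ⟨N, fun m hm => ?_⟩
  rw [Real.dist_eq]
  exact (hN m hm p le_rfl).trans_lt (half_lt_self hε)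

end DualLimit

/-! ### The conjugate of the radial limit is the epi-limit. -/

section EpiLimit

variable {n : ℕ} {ψ : EuclideanSpace ℝ (Fin n) → EReal} {u : ℕ → EuclideanSpace ℝ (Fin n)}
  {α : EuclideanSpace ℝ (Fin n) → ℝ}

/-- The Legendre conjugate of `α`, restricted to the ball `dualInball ψ`. -/
def radialEnvelope (ψ : EuclideanSpace ℝ (Fin n) → EReal) (α : EuclideanSpace ℝ (Fin n) → ℝ)
    (x : EuclideanSpace ℝ (Fin n)) : EReal :=
  ⨆ p : dualInball ψ, ((inner ℝ (p : EuclideanSpace ℝ (Fin n)) x - α p : ℝ) : EReal)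

lemma radialEnvelope_le_iff {x : EuclideanSpace ℝ (Fin n)} {t : ℝ} :
    radialEnvelope ψ α x ≤ t ↔ ∀ p ∈ dualInball ψ, inner ℝ p x - α p ≤ t := by
  simp only [radialEnvelope, iSup_le_iff, EReal.coe_le_coe_iff, Subtype.forall]

lemma le_radialEnvelope {p : EuclideanSpace ℝ (Fin n)} (hp : p ∈ dualInball ψ)
    (x : EuclideanSpace ℝ (Fin n)) :
    ((inner ℝ p x - α p : ℝ) : EReal) ≤ radialEnvelope ψ α x :=
  le_iSup (fun p : dualInball ψ =>
    ((inner ℝ (p : EuclideanSpace ℝ (Fin n)) x - α p : ℝ) : EReal)) ⟨p, hp⟩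

lemma dualInball_of_norm_eq {p q : EuclideanSpace ℝ (Fin n)} (hp : p ∈ dualInball ψ)
    (hq : ‖q‖ = ‖p‖) : q ∈ dualInball ψ := by
  obtain ⟨ρ, hpρ, hρ⟩ := hp
  exact ⟨ρ, by rwa [hq], hρ⟩

lemma IsConvC.dualInball_subset_iterMinkSym (h : IsConvC ψ) (u : ℕ → EuclideanSpace ℝ (Fin n))
    (m : ℕ) : dualInball ψ ⊆ dualDom (HypoSym.iterMinkSym u ψ m) := by
  rintro p ⟨ρ, hpρ, hρ⟩
  exact h.ball_subset_dualDom_iterMinkSym u hρ m (by simpa using hpρ)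

lemma IsDualLimit.radialEnvelope_invariant (hα : IsDualLimit u ψ α)
    (A : EuclideanSpace ℝ (Fin n) ≃ₗᵢ[ℝ] EuclideanSpace ℝ (Fin n))
    (x : EuclideanSpace ℝ (Fin n)) : radialEnvelope ψ α (A x) = radialEnvelope ψ α x := by
  have key : ∀ (A : EuclideanSpace ℝ (Fin n) ≃ₗᵢ[ℝ] EuclideanSpace ℝ (Fin n)) x,
      radialEnvelope ψ α (A x) ≤ radialEnvelope ψ α x := by
    intro A x
    refine iSup_le fun p => ?_
    have hn : ‖A.symm p‖ = ‖(p : EuclideanSpace ℝ (Fin n))‖ := A.symm.norm_map _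
    refine le_trans (le_of_eq ?_) (le_radialEnvelope (dualInball_of_norm_eq p.2 hn) x)
    rw [hα.radial p p.2 _ hn, ← A.inner_map_map (A.symm p) x, A.apply_symm_apply]
  refine le_antisymm (key A x) ?_
  simpa using key A.symm (A x)

theorem IsDualLimit.isConvC_radialEnvelope (h : IsConvC ψ) (hα : IsDualLimit u ψ α)
    {e : EuclideanSpace ℝ (Fin n)} (he : ‖e‖ = 1) : IsConvC (radialEnvelope ψ α) := by
  obtain ⟨a, ha, b, hb⟩ := h.exists_growth
  have hball : Metric.ball 0 a ⊆ dualDom ψ :=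
    Metric.ball_subset_closedBall.trans (closedBall_subset_dualDom hb)
  have hin : ∀ p : EuclideanSpace ℝ (Fin n), ‖p‖ < a → p ∈ dualInball ψ :=
    fun p hp => ⟨a, hp, hball⟩
  have h0 : (0 : EuclideanSpace ℝ (Fin n)) ∈ dualInball ψ := hin 0 (by simpa using ha)
  -- A limit of convex functions that is even is minimal at the origin; this makes the envelope
  -- finite at `0`.
  have hmin : ∀ p ∈ dualInball ψ, α 0 ≤ α p := by
    intro p hp
    have hp' : -p ∈ dualInball ψ := dualInball_of_norm_eq hp (norm_neg p)
    have hlim : Tendsto (fun m => (1 / 2 : ℝ) • dual (iterMinkSym u ψ m) p +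
        (1 / 2 : ℝ) • dual (iterMinkSym u ψ m) (-p)) atTop
        (𝓝 ((1 / 2 : ℝ) • α p + (1 / 2 : ℝ) • α (-p))) :=
      ((hα.tendsto hp).const_smul _).add ((hα.tendsto hp').const_smul _)
    have hle := le_of_tendsto_of_tendsto' (hα.tendsto h0) hlim fun m => by
      have := (h.iterMinkSym u m).convexOn_dual.2 (h.dualInball_subset_iterMinkSym u m hp)
        (h.dualInball_subset_iterMinkSym u m hp') (show (0 : ℝ) ≤ 1 / 2 by norm_num)
        (show (0 : ℝ) ≤ 1 / 2 by norm_num) (by norm_num)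
      rwa [smul_neg, add_neg_cancel] at this
    rw [← hα.radial p hp (-p) (norm_neg p), smul_eq_mul] at hle
    linarith
  have hea : ‖(a / 2) • e‖ = a / 2 := by
    rw [norm_smul, he, mul_one, Real.norm_of_nonneg (by positivity)]
  have hei : (a / 2) • e ∈ dualInball ψ := hin _ (by rw [hea]; linarith)
  -- Test with the slope of norm `a / 2` pointing along `x`; radiality makes its `α`-value
  -- independent of `x`.
  have hgrow : ∀ x, ((a / 2 * ‖x‖ + -α ((a / 2) • e) : ℝ) : EReal) ≤ radialEnvelope ψ α x := by
    intro x
    rcases eq_or_ne x 0 with rfl | hx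
    · have := le_radialEnvelope (α := α) hei (0 : EuclideanSpace ℝ (Fin n))
      simpa using this
    · have hx0 : 0 < ‖x‖ := norm_pos_iff.2 hx
      have hn : ‖(a / 2 / ‖x‖) • x‖ = ‖(a / 2) • e‖ := by
        rw [norm_smul, Real.norm_of_nonneg (by positivity), hea]
        field_simp
      refine le_trans (le_of_eq ?_)
        (le_radialEnvelope (α := α) (dualInball_of_norm_eq hei hn) x)
      rw [← hα.radial _ hei _ hn, real_inner_smul_left, real_inner_self_eq_norm_sq]
      congr 1
      field_simp
      ring
  refine ⟨?_, ?_, ⟨0, ?_⟩, ?_, coercive_of_growth (half_pos ha) hgrow⟩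
  · rintro ⟨x, s⟩ hx ⟨y, t⟩ hy c d hc hd hcd
    simp only [Set.mem_ofPred_eq, radialEnvelope_le_iff] at hx hy
    change radialEnvelope ψ α (c • x + d • y) ≤ ((c • s + d • t : ℝ) : EReal)
    rw [radialEnvelope_le_iff]
    intro p hp
    have h1 := mul_le_mul_of_nonneg_left (hx p hp) hc
    have h2 := mul_le_mul_of_nonneg_left (hy p hp) hd
    have h3 : α p = c * α p + d * α p := by rw [← add_mul, hcd, one_mul]
    rw [inner_add_right, real_inner_smul_right, real_inner_smul_right, smul_eq_mul, smul_eq_mul]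
    linarith
  · intro x hx
    have := hgrow x
    rw [hx] at this
    exact absurd (le_bot_iff.1 this) (EReal.coe_ne_bot _)
  · refine lt_of_le_of_lt (radialEnvelope_le_iff.2 fun p hp => ?_) (EReal.coe_lt_top (-α 0))
    rw [inner_zero_right]
    linarith [hmin p hp]
  · refine lowerSemicontinuous_iSup fun p => Continuous.lowerSemicontinuous ?_
    exact continuous_coe_real_ereal.comp (by fun_prop)

lemma exists_inner_add_mul (f : StrongDual ℝ (EuclideanSpace ℝ (Fin n) × ℝ)) :
    ∃ (q : EuclideanSpace ℝ (Fin n)) (β : ℝ), ∀ y s, f (y, s) = inner ℝ q y + s * β := by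
  refine ⟨(InnerProductSpace.toDual ℝ _).symm
    (f.comp (ContinuousLinearMap.inl ℝ (EuclideanSpace ℝ (Fin n)) ℝ)), f (0, 1), fun y s => ?_⟩
  rw [InnerProductSpace.toDual_symm_apply, ← smul_eq_mul, ← map_smul,
    ContinuousLinearMap.comp_apply, ← map_add]
  simp

lemma disjoint_ball_prod_epigraph {x : EuclideanSpace ℝ (Fin n)} {t ε : ℝ}
    (hx : ∀ y, ‖y - x‖ < ε → ¬ ψ y ≤ t) : Disjoint (Metric.ball x ε ×ˢ Set.Iio t)
      {k : EuclideanSpace ℝ (Fin n) × ℝ | ψ k.1 ≤ (k.2 : EReal)} := by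
  rw [Set.disjoint_left]
  rintro ⟨y, s⟩ ⟨hy, hs⟩ hk
  refine hx y (mem_ball_iff_norm.1 hy) (le_trans hk ?_)
  exact EReal.coe_le_coe_iff.2 (le_of_lt hs)

lemma IsConvC.exists_separating_functional (h : IsConvC ψ) {x : EuclideanSpace ℝ (Fin n)} {t ε : ℝ}
    (hx : ∀ y, ‖y - x‖ < ε → ¬ ψ y ≤ t) :
    ∃ (f : StrongDual ℝ (EuclideanSpace ℝ (Fin n) × ℝ)) (v : ℝ),
      (∀ k ∈ Metric.ball x ε ×ˢ Set.Iio t, f k < v) ∧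
      ∀ k : EuclideanSpace ℝ (Fin n) × ℝ, ψ k.1 ≤ (k.2 : EReal) → v ≤ f k :=
  geometric_hahn_banach_open ((convex_ball x ε).prod (convex_Iio t))
    (Metric.isOpen_ball.prod isOpen_Iio) h.convex (disjoint_ball_prod_epigraph hx)

lemma IsConvC.exists_separation (h : IsConvC ψ) {x : EuclideanSpace ℝ (Fin n)} {t ε : ℝ}
    (hx : ∀ y, ‖y - x‖ < ε → ¬ ψ y ≤ t) :
    ∃ (q : EuclideanSpace ℝ (Fin n)) (β : ℝ), ∀ (y' y : EuclideanSpace ℝ (Fin n)) (s' s : ℝ),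
      ‖y' - x‖ < ε → s' < t → ψ y ≤ s → inner ℝ q y' + s' * β < inner ℝ q y + s * β := by
  obtain ⟨f, v, hf1, hf2⟩ := h.exists_separating_functional hx
  obtain ⟨q, β, hfe⟩ := exists_inner_add_mul f
  refine ⟨q, β, fun y' y s' s hy' hs' hy => ?_⟩
  rw [← hfe, ← hfe]
  exact (hf1 (y', s') ⟨mem_ball_iff_norm.2 hy', hs'⟩).trans_le (hf2 (y, s) hy)

/-- A convex function exceeding `t` on a ball is bounded below by an affine function exceeding
`t` on a smaller ball. -/
theorem IsConvC.exists_affine_minorant (h : IsConvC ψ) {x : EuclideanSpace ℝ (Fin n)} {t ε : ℝ}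
    (hε : 0 < ε) (hx : ∀ y, ‖y - x‖ < ε → ¬ ψ y ≤ t) :
    ∃ p : EuclideanSpace ℝ (Fin n), ∀ (y : EuclideanSpace ℝ (Fin n)) (s : ℝ), ψ y ≤ s →
      t + inner ℝ p (y - x) + ε / 4 * ‖p‖ ≤ s := by
  obtain ⟨q, β, hsep⟩ := h.exists_separation hx
  obtain ⟨x₀, hx₀⟩ := h.dom_nonempty
  obtain ⟨s₀, hs₀⟩ := exists_coe_of_lt_top h.ne_bot hx₀
  have hβ0 : 0 ≤ β := by
    by_contra hneg
    push Not at hneg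
    set D := inner ℝ q x + (t - 1) * β - inner ℝ q x₀ with hD
    set s := max s₀ (D / β) with hs
    have h1 := hsep x x₀ (t - 1) s (by simpa using hε) (by linarith)
      (hs₀.le.trans (by exact_mod_cast le_max_left _ _))
    have h2 : D / β ≤ s := le_max_right _ _
    rw [div_le_iff_of_neg hneg] at h2
    linarith
  have hnn : ∀ p : EuclideanSpace ℝ (Fin n), inner ℝ p (‖p‖⁻¹ • p) = ‖p‖ := by
    intro p
    rcases eq_or_ne p 0 with rfl | hp
    · simp
    · have : ‖p‖ ≠ 0 := norm_ne_zero_iff.2 hp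
      rw [real_inner_smul_right, real_inner_self_eq_norm_sq]
      field_simp
  -- Testing the separation at the point `ε / 2` away from `x` along `q` gains the margin `ε / 2 *
  -- ‖q‖`.
  have hshift : ∀ (p : EuclideanSpace ℝ (Fin n)), ‖(x + (ε / 2) • ‖p‖⁻¹ • p) - x‖ < ε := by
    intro p
    rw [add_sub_cancel_left, norm_smul, norm_smul, norm_inv, norm_norm,
      Real.norm_of_nonneg (by positivity)]
    have : ‖p‖⁻¹ * ‖p‖ ≤ 1 := inv_mul_le_one
    nlinarith
  have hbase : ∀ (y : EuclideanSpace ℝ (Fin n)) (s s' : ℝ), s' < t → ψ y ≤ s →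
      inner ℝ q x + ε / 2 * ‖q‖ + s' * β < inner ℝ q y + s * β := by
    intro y s s' hs' hy
    have := hsep _ y s' s (hshift q) hs' hy
    rwa [inner_add_right, real_inner_smul_right, hnn] at this
  rcases hβ0.eq_or_lt with hβz | hβp
  · have hvert : ∀ (y : EuclideanSpace ℝ (Fin n)) (s : ℝ), ψ y ≤ s →
        ε / 2 * ‖q‖ < inner ℝ q (y - x) := by
      intro y s hy
      have := hbase y s (t - 1) (by linarith) hy
      rw [← hβz] at this
      rw [inner_sub_right]
      linarith
    have hq0 : 0 < ‖q‖ := by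
      rw [norm_pos_iff]
      intro hq0
      have := hvert x₀ s₀ hs₀.le
      rw [hq0] at this
      simp at this
    obtain ⟨a, ha, b, hb⟩ := h.exists_growth
    -- The separating hyperplane is vertical, so the lower bound `b` of `ψ` replaces it: the slope
    -- `-k • q` is steep enough to bring the affine function below `b` on the effective domain.
    set k : ℝ := |t - b| / (ε / 4 * ‖q‖) with hk
    have hk0 : 0 ≤ k := by positivity
    refine ⟨-(k • q), fun y s hy => ?_⟩
    have h1 := hvert y s hy
    have h2 := (hb y).trans hy
    rw [EReal.coe_le_coe_iff] at h2
    have h3 : 0 ≤ a * ‖y‖ := by positivity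
    have h4 : k * (ε / 4 * ‖q‖) = |t - b| := by rw [hk]; field_simp
    have h5 := le_abs_self (t - b)
    rw [inner_neg_left, real_inner_smul_left, norm_neg, norm_smul, Real.norm_of_nonneg hk0]
    have h6 := mul_le_mul_of_nonneg_left h1.le hk0
    linarith
  · refine ⟨-(β⁻¹ • q), fun y s hy => ?_⟩
    rw [inner_neg_left, real_inner_smul_left, norm_neg, norm_smul,
      Real.norm_of_nonneg (by positivity)]
    refine le_of_forall_lt fun w hw => ?_
    set s' := w + β⁻¹ * inner ℝ q (y - x) - ε / 4 * (β⁻¹ * ‖q‖) with hs'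
    have h1 := hbase y s s' (by rw [hs']; linarith) hy
    have h2 : s' * β = w * β + inner ℝ q (y - x) - ε / 4 * ‖q‖ := by
      rw [hs']; field_simp
    rw [h2, inner_sub_right] at h1
    have h3 : w * β < s * β := by
      have : 0 ≤ ε / 4 * ‖q‖ := by positivity
      linarith
    exact lt_of_mul_lt_mul_right h3 hβp.le

/-- The origin is fixed by every reflection; this gives a constant uniform in `m` for convexity
along rays. -/
lemma IsConvC.dual_iterMinkSym_zero (h : IsConvC ψ) (u : ℕ → EuclideanSpace ℝ (Fin n)) (m : ℕ) :
    dual (HypoSym.iterMinkSym u ψ m) 0 = dual ψ 0 := by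
  induction m with
  | zero => rfl
  | succ m ih =>
    have h0 := (h.iterMinkSym u m).zero_mem_dualDom
    have hr : refl (u m) 0 = 0 := map_zero _
    refine ((h.iterMinkSym u m).dual_minkSym (u m) h0 (by rwa [hr])).trans ?_
    rw [hr, ih]
    ring

/-- A radius inside the domain of the conjugate which points of the domains of later conjugates
exceed by at most a small proportion, or which is large. -/
lemma IsConvC.exists_radius (h : IsConvC ψ)
    (hout : ∀ (ρ : ℚ) (p₀), p₀ ∉ dualDom ψ → ‖p₀‖ < ρ →
        ∀ᶠ m in atTop, ∀ p, (ρ : ℝ) ≤ ‖p‖ → p ∉ dualDom (HypoSym.iterMinkSym u ψ m))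
    {C κ : ℝ} (hC : 0 ≤ C) (hκ : 0 < κ) :
    ∃ r ρ : ℝ, 0 < r ∧ r < ρ ∧ Metric.ball 0 ρ ⊆ dualDom ψ ∧
      ∀ᶠ m in atTop, ∀ p ∈ dualDom (HypoSym.iterMinkSym u ψ m), r ≤ ‖p‖ →
        (1 - r / ‖p‖) * C ≤ κ * r := by
  by_cases hall : ∃ p₀, p₀ ∉ dualDom ψ
  · obtain ⟨p₀, hp₀⟩ := hall
    obtain ⟨a, ha, b, hb⟩ := h.exists_growth
    set S : Set ℝ := {ρ | Metric.ball 0 ρ ⊆ dualDom ψ} with hS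
    have hSb : BddAbove S := by
      refine ⟨‖p₀‖, fun ρ hρ => le_of_not_gt fun hlt => hp₀ (hρ (by simpa using hlt))⟩
    have haS : a ∈ S := Metric.ball_subset_closedBall.trans (closedBall_subset_dualDom hb)
    set R := sSup S with hR
    have hR0 : 0 < R := ha.trans_le (le_csSup hSb haS)
    -- With `r = R - c` and later domains inside radius `R + c`, the excess `1 - r / ‖p‖` is at most
    -- `2 * c / ‖p‖`; `c` makes `2 * c * C ≤ κ * R ^ 2 / 4 ≤ κ * r * ‖p‖`.
    set c : ℝ := min (R / 2) (κ * R ^ 2 / (8 * (C + 1))) with hc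
    have hc0 : 0 < c := lt_min (by positivity) (by positivity)
    have hc1 : c ≤ R / 2 := min_le_left _ _
    have hc2 : c * (8 * (C + 1)) ≤ κ * R ^ 2 := by
      rw [← le_div_iff₀ (by positivity)]
      exact min_le_right _ _
    obtain ⟨ρ, hρS, hρ⟩ := exists_lt_of_lt_csSup ⟨a, haS⟩ (show R - c < sSup S by linarith)
    obtain ⟨σ, hσ1, hσ2⟩ := exists_rat_btwn (show R < R + c by linarith)
    have hbad : ∃ p₁, p₁ ∉ dualDom ψ ∧ ‖p₁‖ < σ := by
      by_contra hcon
      push Not at hcon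
      have : (σ : ℝ) ∈ S := fun p hp => by
        by_contra hp'
        exact absurd (hcon p hp') (not_le.2 (by simpa using hp))
      exact absurd (le_csSup hSb this) (not_le.2 hσ1)
    obtain ⟨p₁, hp₁, hp₁σ⟩ := hbad
    refine ⟨R - c, ρ, by linarith, hρ, hρS, ?_⟩
    filter_upwards [hout σ p₁ hp₁ hp₁σ] with m hm p hp hrp
    have hpσ : ‖p‖ < σ := by
      by_contra hcon
      exact hm p (not_lt.1 hcon) hp
    have hp0 : 0 < ‖p‖ := by linarith
    have e : (1 - (R - c) / ‖p‖) = (‖p‖ - (R - c)) / ‖p‖ := by field_simp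
    rw [e, div_mul_eq_mul_div, div_le_iff₀ hp0]
    have h1 : (‖p‖ - (R - c)) * C ≤ (2 * c) * C := by
      apply mul_le_mul_of_nonneg_right _ hC
      linarith
    have h2 : 2 * c * C ≤ κ * R ^ 2 / 4 := by nlinarith
    have h3 : R / 2 * (R / 2) ≤ (R - c) * ‖p‖ := by
      apply mul_le_mul <;> linarith
    nlinarith [mul_le_mul_of_nonneg_left h3 hκ.le]
  · push Not at hall
    -- The domain is the whole space, so `r` can be taken with `C ≤ κ * r`.
    refine ⟨C / κ + 1, C / κ + 2, by positivity, by linarith, fun p _ => hall p,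
      Eventually.of_forall fun m p _ hp => ?_⟩
    have h1 : 0 ≤ (C / κ + 1) / ‖p‖ := by positivity
    have h2 : (1 - (C / κ + 1) / ‖p‖) * C ≤ 1 * C := by
      apply mul_le_mul_of_nonneg_right _ hC
      linarith
    have h3 : κ * (C / κ + 1) = C + κ := by field_simp
    linarith

/-- Otherwise an affine minorant above `t` near `x` has a slope `p` with conjugate at most `⟨p, x⟩ -
t`, with a margin proportional to `‖p‖`. If `‖p‖ ≤ r`, uniform convergence contradicts the bound on
the envelope; if not, `p` is first shrunk to norm `r`, and the margin pays for the convexity error.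
-/
lemma IsDualLimit.eventually_exists_le (h : IsConvC ψ) (hα : IsDualLimit u ψ α)
    (hout : ∀ (ρ : ℚ) (p₀), p₀ ∉ dualDom ψ → ‖p₀‖ < ρ →
        ∀ᶠ m in atTop, ∀ p, (ρ : ℝ) ≤ ‖p‖ → p ∉ dualDom (iterMinkSym u ψ m))
    {x : EuclideanSpace ℝ (Fin n)} {t' t ε : ℝ} (hx : radialEnvelope ψ α x ≤ t') (ht : t' < t)
    (hε : 0 < ε) : ∀ᶠ m in atTop, ∃ y, ‖y - x‖ < ε ∧ iterMinkSym u ψ m y ≤ t := by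
  obtain ⟨r, ρ, hr0, hrρ, hρ, hrad⟩ := h.exists_radius hout (C := |dual ψ 0 + t|) (κ := ε / 4)
    (abs_nonneg _) (by linarith)
  filter_upwards [hrad, hα.uniform r ρ ((t - t') / 2) hrρ hρ (by linarith)] with m hm hunif
  by_contra hcon
  push Not at hcon
  have hφ := h.iterMinkSym u m
  obtain ⟨p, hp⟩ := hφ.exists_affine_minorant hε (fun y hy => not_le.2 (hcon y hy))
  have hp' : ∀ (y : EuclideanSpace ℝ (Fin n)) (s : ℝ), iterMinkSym u ψ m y ≤ s →
      inner ℝ p y - s ≤ inner ℝ p x - t - ε / 4 * ‖p‖ := by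
    intro y s hy
    have := hp y s hy
    rw [inner_sub_right] at this
    linarith
  have hpD : p ∈ dualDom (iterMinkSym u ψ m) := mem_dualDom_of_le hp'
  have hFp : dual (iterMinkSym u ψ m) p ≤ inner ℝ p x - t - ε / 4 * ‖p‖ := hφ.dual_le hp'
  have hcontra : ∀ q : EuclideanSpace ℝ (Fin n), ‖q‖ ≤ r →
      dual (iterMinkSym u ψ m) q ≤ inner ℝ q x - t → False := by
    intro q hq hle
    have h1 := radialEnvelope_le_iff.1 hx q ⟨ρ, hq.trans_lt hrρ, hρ⟩
    have h2 := (abs_le.1 (hunif q hq)).1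
    linarith
  have hpn : 0 ≤ ε / 4 * ‖p‖ := by positivity
  by_cases hpr : ‖p‖ ≤ r
  · exact hcontra p hpr (by linarith)
  · push Not at hpr
    have hp0 : 0 < ‖p‖ := hr0.trans hpr
    set l : ℝ := r / ‖p‖ with hl
    have hl0 : 0 < l := by positivity
    have hl1 : l ≤ 1 := by rw [hl, div_le_one hp0]; exact hpr.le
    have hln : l * ‖p‖ = r := by rw [hl]; field_simp
    have hconv := hφ.convexOn_dual.2 hφ.zero_mem_dualDom hpD (sub_nonneg.2 hl1) hl0.le (by ring)
    rw [smul_zero, zero_add, h.dual_iterMinkSym_zero, smul_eq_mul, smul_eq_mul] at hconv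
    refine hcontra (l • p) ?_ ?_
    · rw [norm_smul, Real.norm_of_nonneg hl0.le, hln]
    · rw [real_inner_smul_left]
      have h1 := hm p hpD hpr.le
      have h2 : (1 - l) * (dual ψ 0 + t) ≤ (1 - l) * |dual ψ 0 + t| :=
        mul_le_mul_of_nonneg_left (le_abs_self _) (by linarith)
      have h3 := mul_le_mul_of_nonneg_left hFp hl0.le
      have h4 : l * (ε / 4 * ‖p‖) = ε / 4 * r := by rw [← hln]; ring
      linarith

/-- Take the largest `k ≤ m` with `P k m`; the eventual truth of `P 0` ensures that one exists. -/
lemma exists_diagonal {P : ℕ → ℕ → Prop} (h : ∀ k, ∀ᶠ m in atTop, P k m) :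
    ∃ κ : ℕ → ℕ, Tendsto κ atTop atTop ∧ ∀ᶠ m in atTop, P (κ m) m := by
  classical
  refine ⟨fun m => Nat.findGreatest (fun k => P k m) m, ?_, ?_⟩
  · rw [tendsto_atTop]
    intro k
    filter_upwards [h k, eventually_ge_atTop k] with m hm hk
    exact Nat.le_findGreatest hk hm
  · filter_upwards [h 0] with m hm
    exact Nat.findGreatest_spec (P := fun k => P k m) (Nat.zero_le m) hm

theorem IsDualLimit.epiConverges (h : IsConvC ψ) (hα : IsDualLimit u ψ α)
    (hout : ∀ (ρ : ℚ) (p₀), p₀ ∉ dualDom ψ → ‖p₀‖ < ρ →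
        ∀ᶠ m in atTop, ∀ p, (ρ : ℝ) ≤ ‖p‖ → p ∉ dualDom (iterMinkSym u ψ m))
    (hne : ∀ x, radialEnvelope ψ α x ≠ ⊥) :
    EpiConverges (iterMinkSym u ψ) (radialEnvelope ψ α) := by
  intro x
  have hinf : ∀ y : ℕ → EuclideanSpace ℝ (Fin n), Tendsto y atTop (𝓝 x) →
      radialEnvelope ψ α x ≤ liminf (fun j => iterMinkSym u ψ j (y j)) atTop := by
    intro y hy
    -- Fenchel's inequality at each stage for a fixed slope `p`, then the limit of the conjugates at
    -- `p`.
    refine iSup_le fun p => ?_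
    have hlim : Tendsto (fun j => ((inner ℝ (p : EuclideanSpace ℝ (Fin n)) (y j) -
        dual (iterMinkSym u ψ j) p : ℝ) : EReal)) atTop
        (𝓝 ((inner ℝ (p : EuclideanSpace ℝ (Fin n)) x - α p : ℝ) : EReal)) :=
      EReal.tendsto_coe.2 ((tendsto_const_nhds.inner hy).sub (hα.tendsto p.2))
    rw [← hlim.liminf_eq]
    refine liminf_le_liminf (Eventually.of_forall fun j => coe_le_of_forall_le fun s hs => ?_)
    linarith [inner_sub_le_dual (h.dualInball_subset_iterMinkSym u j p.2) hs]
  refine ⟨hinf, ?_⟩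
  rcases eq_or_ne (radialEnvelope ψ α x) ⊤ with htop | htop
  · refine ⟨fun _ => x, tendsto_const_nhds, ?_⟩
    have := hinf (fun _ => x) tendsto_const_nhds
    exact tendsto_of_le_liminf_of_limsup_le this (by rw [htop]; exact le_top)
  · obtain ⟨c, hc⟩ := exists_coe_of_lt_top hne (lt_top_iff_ne_top.2 htop)
    obtain ⟨κ, hκ, hP⟩ := exists_diagonal (P := fun k m => ∃ y, ‖y - x‖ < 1 / ((k : ℝ) + 1) ∧
      iterMinkSym u ψ m y ≤ ((c + 1 / ((k : ℝ) + 1) : ℝ) : EReal)) fun k =>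
        hα.eventually_exists_le h hout hc.le
          (lt_add_of_pos_right c (by positivity)) (by positivity)
    have hex : ∀ m, ∃ y, (∃ y, ‖y - x‖ < 1 / ((κ m : ℝ) + 1) ∧
        iterMinkSym u ψ m y ≤ ((c + 1 / ((κ m : ℝ) + 1) : ℝ) : EReal)) →
        ‖y - x‖ < 1 / ((κ m : ℝ) + 1) ∧
          iterMinkSym u ψ m y ≤ ((c + 1 / ((κ m : ℝ) + 1) : ℝ) : EReal) := by
      intro m
      by_cases hm : ∃ y, ‖y - x‖ < 1 / ((κ m : ℝ) + 1) ∧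
        iterMinkSym u ψ m y ≤ ((c + 1 / ((κ m : ℝ) + 1) : ℝ) : EReal)
      · obtain ⟨y, hy⟩ := hm
        exact ⟨y, fun _ => hy⟩
      · exact ⟨x, fun h => absurd h hm⟩
    choose y hy using hex
    have hk0 : Tendsto (fun m => 1 / ((κ m : ℝ) + 1)) atTop (𝓝 0) :=
      tendsto_one_div_add_atTop_nhds_zero_nat.comp hκ
    have hyx : Tendsto y atTop (𝓝 x) := by
      rw [tendsto_iff_norm_sub_tendsto_zero]
      refine squeeze_zero' (Eventually.of_forall fun _ => norm_nonneg _) ?_ hk0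
      filter_upwards [hP] with m hm
      exact (hy m hm).1.le
    refine ⟨y, hyx, tendsto_of_le_liminf_of_limsup_le (hinf y hyx) ?_⟩
    have hlim : Tendsto (fun m => ((c + 1 / ((κ m : ℝ) + 1) : ℝ) : EReal)) atTop (𝓝 (c : EReal)) := by
      rw [EReal.tendsto_coe]
      simpa using hk0.const_add c
    rw [hc, ← hlim.limsup_eq]
    refine limsup_le_limsup ?_
    filter_upwards [hP] with m hm
    exact (hy m hm).2

theorem IsConvC.exists_isEpiSymmetrization (h : IsConvC ψ) (hn : 1 ≤ n) :
    ∃ φ, IsEpiSymmetrization ψ φ := by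
  have he : ‖EuclideanSpace.single (⟨0, hn⟩ : Fin n) (1 : ℝ)‖ = 1 := by simp
  obtain ⟨u, hu, hosc, hout⟩ := h.exists_symmetrizing_directions he
  obtain ⟨α, hα⟩ := h.exists_isDualLimit hosc
  have hconv := hα.isConvC_radialEnvelope h he
  exact ⟨radialEnvelope ψ α, hconv, hα.radialEnvelope_invariant, u, hu,
    hα.epiConverges h hout hconv.ne_bot⟩

end EpiLimit

end HypoSym

end

theorem corollary6p4 (n : ℕ) (hn : 1 ≤ n) (f : EuclideanSpace ℝ (Fin n) → ℝ)
    (hf : f ∈ HypoSym.LCc n) :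
    MeasureTheory.Integrable f ∧
    (∃ g : EuclideanSpace ℝ (Fin n) → ℝ, HypoSym.IsHypoSymmetrization f g) ∧
    ∀ g : EuclideanSpace ℝ (Fin n) → ℝ, HypoSym.IsHypoSymmetrization f g →
      MeasureTheory.Integrable g ∧ HypoSym.totalMass f ≤ HypoSym.totalMass g := by
  obtain ⟨ψ, hψ, rfl⟩ := hf
  refine ⟨hψ.integrable_expNeg, ?_, ?_⟩
  · obtain ⟨φ, hφ⟩ := hψ.exists_isEpiSymmetrization hn
    exact ⟨HypoSym.expNeg φ, ψ, φ, hψ, rfl, hφ, rfl⟩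
  · rintro g ⟨ψ', φ, hψ', hf, hφ, rfl⟩
    refine ⟨hφ.isConvC.integrable_expNeg, ?_⟩
    rw [hf]
    exact hφ.totalMass_le hψ'
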